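/- Let $\Gamma$ be an additive abelian group. A $\Gamma$-labelled graph is a pair $(G,\gamma)$ of a finite graph $G$ (parallel edges and loops allowed) and a map $\gamma:V(G)\to\Gamma$. A set $F\subseteq E(G)$ is acyclic if the subgraph $(V(G),F)$ has no cycle, and it is $\gamma$-nonzero if, for each component $C$ of $(V(G),F)$, (G1) $\sum_{v\in V(C)}\gamma(v)\neq 0$ or $\gamma|_{V(C)}\equiv 0$, and (G2) if $\gamma|_{V(C)}\equiv 0$, then $G[V(C)]$ is a component of $G$. In the problem Maximum Weight Acyclic $\gamma$-nonzero Set, the input is a $\Gamma$-labelled graph $(G,\gamma)$ and a weight $w:E(G)\to\mathbb{Q}$, and the task is to find an acyclic $\gamma$-nonzero set $F$ in $G$ maximizing $\sum_{e\in F}w(e)$. Theorem. Assume that adding two elements of $\Gamma$ and testing whether an element of $\Gamma$ is zero can be done in time polynomial in the length of the input (it suffices that this holds for elements of the form $\sum_{v\in A}\gamma(v)$ with $A\subseteq V(G)$). Then Maximum Weight Acyclic $\gamma$-nonzero Set is solvable in polynomial time. More precisely, there is one algorithm for all abelian groups, using elements of $\Gamma$ only through additions and zero tests, such that for every polynomial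 $q$ there is a polynomial $p$ with the following property: on every input of length $N$ for which each of these group operations takes at most $q(N)$ steps, the algorithm halts after at most $p(N)$ steps and outputs an acyclic $\gamma$-nonzero set of maximum weight. -/

import Mathlib

noncomputable section

namespace GammaGraphic

/-! ### Labelled graphs

Graphs are Mathlib's multigraphs `Graph α β` (parallel edges and loops allowed). -/

section Graphs

variable {α β : Type*}

/-- The component of `H` containing `x`: the subgraph induced on all vertices reachable
from `x` by a walk in `H`. -/
def component (H : Graph α β) (x : α) : Graph α β :=
  H.induce {y | Relation.ReflTransGen H.Adj x y}

/-- `C` is a component of `H`. -/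
def IsComponent (H C : Graph α β) : Prop :=
  ∃ x ∈ H.vertexSet, C = component H x

/-- `H` has a cycle: distinct vertices `v 0, …, v k` and distinct edges `e 0, …, e k` such that
`e i` joins `v i` to its cyclic successor (a loop for `k = 0`, a pair of parallel edges for
`k = 1`). -/
def HasCycle (H : Graph α β) : Prop :=
  ∃ (k : ℕ) (v : Fin (k + 1) → α) (e : Fin (k + 1) → β),
    Function.Injective v ∧ Function.Injective e ∧ ∀ i, H.IsLink (e i) (v i) (v (i + 1))

variable {Γ : Type*} [AddCommGroup Γ]

/-- The subgraph `H` of the (finite) graph `G` is `γ`-nonzero in `G`. -/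
def IsNonzeroSubgraph (G : Graph α β) (γ : α → Γ) (H : Graph α β) : Prop :=
  ∀ C, IsComponent H C →
    ((∑ᶠ v ∈ C.vertexSet, γ v) ≠ 0 ∨ ∀ v ∈ C.vertexSet, γ v = 0) ∧
    ((∀ v ∈ C.vertexSet, γ v = 0) → IsComponent G (G.induce C.vertexSet))

/-- The edge set `F` is acyclic in `G`. -/
def IsAcyclicSet (G : Graph α β) (F : Set β) : Prop :=
  ¬ HasCycle (G.restrict F)

/-- The edge set `F` is `γ`-nonzero in `G`: the spanning subgraph `(V(G), F)` is. -/
def IsNonzeroSet (G : Graph α β) (γ : α → Γ) (F : Set β) : Prop :=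
  IsNonzeroSubgraph G γ (G.restrict F)

end Graphs

/-! ### Instances of the optimization problem -/

/-- An instance: a finite graph with vertices `0, …, n - 1` and edges `0, …, m - 1`, given by the
list of the ends of its edges, together with vertex labels in `Γ` and rational edge weights. -/
structure Input (Γ : Type*) where
  /-- number of vertices -/
  n : ℕ
  /-- number of edges -/
  m : ℕ
  /-- the two ends of each edge -/
  ends : Fin m → Fin n × Fin n
  /-- the labelling `γ` -/
  label : Fin n → Γ
  /-- the weight `w` -/
  weight : Fin m → ℚ

/-- The multigraph of an instance. -/
def Input.graph {Γ : Type*} (I : Input Γ) : Graph (Fin I.n) (Fin I.m) where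
  vertexSet := Set.univ
  edgeSet := Set.univ
  IsLink e x y := I.ends e = (x, y) ∨ I.ends e = (y, x)
  isLink_symm := fun _ _ => ⟨fun _ _ h => h.symm⟩
  eq_or_eq_of_isLink_of_isLink := by
    rintro e x y v w (h | h) (h' | h') <;> rw [h] at h' <;> simp_all
  edge_mem_iff_exists_isLink := fun e =>
    ⟨fun _ => ⟨(I.ends e).1, (I.ends e).2, Or.inl rfl⟩, fun _ => Set.mem_univ e⟩
  left_mem_of_isLink := fun _ _ _ _ => Set.mem_univ _

/-- `F` is an acyclic `γ`-nonzero set of the instance. -/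
def Input.IsFeasible {Γ : Type*} [AddCommGroup Γ] (I : Input Γ) (F : Finset (Fin I.m)) : Prop :=
  IsAcyclicSet I.graph (F : Set (Fin I.m)) ∧
    IsNonzeroSet I.graph I.label (F : Set (Fin I.m))

/-- How elements of `Γ` are handled by a computer: the length of the code of an element, the
number of steps needed to add two elements, and the number of steps needed to test whether an
element is zero. -/
structure GroupCosts (Γ : Type*) where
  /-- length of the code of an element -/
  codeLength : Γ → ℕ
  /-- number of steps for adding two elements -/
  addTime : Γ → Γ → ℕ
  /-- number of steps for testing whether an element is zero -/
  zeroTime : Γ → ℕ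

/-- The length of the input: all codes of labels, the ends of all edges in binary, and the
numerators and denominators of all weights in binary, each item with a separator. -/
def Input.length {Γ : Type*} (I : Input Γ) (T : GroupCosts Γ) : ℕ :=
  (∑ v, (T.codeLength (I.label v) + 1)) +
    ∑ e, (Nat.size (I.ends e).1 + Nat.size (I.ends e).2 +
      Nat.size (I.weight e).num.natAbs + Nat.size (I.weight e).den + 4)

/-- On the sums of labels over sets of vertices, adding two elements and testing whether an
element is zero take at most `b` steps. -/
def Input.OpsBoundedBy {Γ : Type*} [AddCommGroup Γ] (I : Input Γ) (T : GroupCosts Γ) (b : ℕ) :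
    Prop :=
  (∀ A B : Finset (Fin I.n), T.addTime (∑ v ∈ A, I.label v) (∑ v ∈ B, I.label v) ≤ b) ∧
    ∀ A : Finset (Fin I.n), T.zeroTime (∑ v ∈ A, I.label v) ≤ b

/-! ### The machine model

A random access machine, programmed in a small structured language. The memory consists of
finitely many (those named in the program) arrays of integers and arrays of elements of `Γ`.
Integer operations are charged according to the bit lengths of the integers involved. Elements of
`Γ` can only be added and tested for being zero, and these operations are charged according to
`GroupCosts`. -/

/-- Integer expressions. `get a i` reads entry `i` of the integer array number `a`. -/
inductive Expr where
  | const (z : ℤ)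
  | get (a : ℕ) (i : Expr)
  | add (x y : Expr)
  | sub (x y : Expr)
  | mul (x y : Expr)
  | lt (x y : Expr)
  | eq (x y : Expr)

/-- Programs. -/
inductive Prog where
  /-- do nothing -/
  | nop
  /-- integer array `a`, entry `i` `:= x` -/
  | set (a : ℕ) (i x : Expr)
  /-- group array `a`, entry `i` `:=` (group array `b`, entry `j`) `+` (group array `c`,
  entry `k`) -/
  | groupAdd (a : ℕ) (i : Expr) (b : ℕ) (j : Expr) (c : ℕ) (k : Expr)
  /-- integer array `a`, entry `i` `:= 1` if group array `b`, entry `j` is zero, else `0` -/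
  | groupIsZero (a : ℕ) (i : Expr) (b : ℕ) (j : Expr)
  /-- run `p`, then `r` -/
  | seq (p r : Prog)
  /-- run `p` if the value of `x` is not `0`, else run `r` -/
  | branch (x : Expr) (p r : Prog)
  /-- run `p` as long as the value of `x` is not `0` -/
  | loop (x : Expr) (p : Prog)

/-- Contents of the memory. -/
structure Memory (Γ : Type*) where
  /-- `int a i` is entry `i` of integer array `a` -/
  int : ℕ → ℕ → ℤ
  /-- `grp a i` is entry `i` of group array `a` -/
  grp : ℕ → ℕ → Γ

/-- Write `z` to entry `i` of integer array `a`. -/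
def Memory.setInt {Γ : Type*} (s : Memory Γ) (a i : ℕ) (z : ℤ) : Memory Γ where
  int := fun a' i' => if a' = a ∧ i' = i then z else s.int a' i'
  grp := s.grp

/-- Write `g` to entry `i` of group array `a`. -/
def Memory.setGrp {Γ : Type*} (s : Memory Γ) (a i : ℕ) (g : Γ) : Memory Γ where
  int := s.int
  grp := fun a' i' => if a' = a ∧ i' = i then g else s.grp a' i'

/-- Length of the binary notation of an integer, with its sign. -/
def intLength (z : ℤ) : ℕ := Nat.size z.natAbs + 1

/-- The value of an expression (a negative array index is read as `0`). -/
def Expr.val {Γ : Type*} (s : Memory Γ) : Expr → ℤ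
  | .const z => z
  | .get a i => s.int a (i.val s).toNat
  | .add x y => x.val s + y.val s
  | .sub x y => x.val s - y.val s
  | .mul x y => x.val s * y.val s
  | .lt x y => if x.val s < y.val s then 1 else 0
  | .eq x y => if x.val s = y.val s then 1 else 0

/-- The number of steps for evaluating an expression, linear in the bit lengths of the integers
involved, except that a product costs the product of the bit lengths of its factors. -/
def Expr.cost {Γ : Type*} (s : Memory Γ) : Expr → ℕ
  | .const z => intLength z
  | .get a i => i.cost s + intLength (s.int a (i.val s).toNat)
  | .add x y => x.cost s + y.cost s + intLength (x.val s) + intLength (y.val s)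
  | .sub x y => x.cost s + y.cost s + intLength (x.val s) + intLength (y.val s)
  | .mul x y => x.cost s + y.cost s + intLength (x.val s) * intLength (y.val s)
  | .lt x y => x.cost s + y.cost s + intLength (x.val s) + intLength (y.val s)
  | .eq x y => x.cost s + y.cost s + intLength (x.val s) + intLength (y.val s)

open Classical in
/-- `Exec T p s s' t`: started on memory `s`, the program `p` halts after exactly `t` steps, and
then the memory is `s'`. -/
inductive Exec {Γ : Type*} [AddCommGroup Γ] (T : GroupCosts Γ) :
    Prog → Memory Γ → Memory Γ → ℕ → Prop
  | nop (s : Memory Γ) : Exec T .nop s s 1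
  | set (s : Memory Γ) (a : ℕ) (i x : Expr) :
      Exec T (.set a i x) s (s.setInt a (i.val s).toNat (x.val s)) (i.cost s + x.cost s + 1)
  | groupAdd (s : Memory Γ) (a : ℕ) (i : Expr) (b : ℕ) (j : Expr) (c : ℕ) (k : Expr) :
      Exec T (.groupAdd a i b j c k) s
        (s.setGrp a (i.val s).toNat (s.grp b (j.val s).toNat + s.grp c (k.val s).toNat))
        (i.cost s + j.cost s + k.cost s +
          T.addTime (s.grp b (j.val s).toNat) (s.grp c (k.val s).toNat) + 1)
  | groupIsZero (s : Memory Γ) (a : ℕ) (i : Expr) (b : ℕ) (j : Expr) :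
      Exec T (.groupIsZero a i b j) s
        (s.setInt a (i.val s).toNat (if s.grp b (j.val s).toNat = 0 then 1 else 0))
        (i.cost s + j.cost s + T.zeroTime (s.grp b (j.val s).toNat) + 1)
  | seq {p r : Prog} {s s' s'' : Memory Γ} {t t' : ℕ} :
      Exec T p s s' t → Exec T r s' s'' t' → Exec T (.seq p r) s s'' (t + t' + 1)
  | branch_true {x : Expr} {p r : Prog} {s s' : Memory Γ} {t : ℕ} :
      x.val s ≠ 0 → Exec T p s s' t → Exec T (.branch x p r) s s' (x.cost s + t + 1)
  | branch_false {x : Expr} {p r : Prog} {s s' : Memory Γ} {t : ℕ} :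
      x.val s = 0 → Exec T r s s' t → Exec T (.branch x p r) s s' (x.cost s + t + 1)
  | loop_true {x : Expr} {p : Prog} {s s' s'' : Memory Γ} {t t' : ℕ} :
      x.val s ≠ 0 → Exec T p s s' t → Exec T (.loop x p) s' s'' t' →
        Exec T (.loop x p) s s'' (x.cost s + t + t' + 1)
  | loop_false {x : Expr} {p : Prog} {s : Memory Γ} :
      x.val s = 0 → Exec T (.loop x p) s s (x.cost s + 1)

/-- The machine is deterministic, so `Exec` determines the output and the running time. -/
theorem Exec.deterministic {Γ : Type*} [AddCommGroup Γ] {T : GroupCosts Γ} {p : Prog}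
    {s s₁ s₂ : Memory Γ} {t₁ t₂ : ℕ} (h₁ : Exec T p s s₁ t₁) (h₂ : Exec T p s s₂ t₂) :
    s₁ = s₂ ∧ t₁ = t₂ := by
  induction h₁ generalizing s₂ t₂ with
  | nop | set | groupAdd | groupIsZero => cases h₂; exact ⟨rfl, rfl⟩
  | seq _ _ ih ih' =>
    cases h₂ with
    | seq g g' =>
      obtain ⟨rfl, rfl⟩ := ih g
      obtain ⟨rfl, rfl⟩ := ih' g'
      exact ⟨rfl, rfl⟩
  | branch_true hx _ ih =>
    cases h₂ with
    | branch_true _ g => obtain ⟨rfl, rfl⟩ := ih g; exact ⟨rfl, rfl⟩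
    | branch_false hx' _ => exact absurd hx' hx
  | branch_false hx _ ih =>
    cases h₂ with
    | branch_true hx' _ => exact absurd hx hx'
    | branch_false _ g => obtain ⟨rfl, rfl⟩ := ih g; exact ⟨rfl, rfl⟩
  | loop_true hx _ _ ih ih' =>
    cases h₂ with
    | loop_true _ g g' =>
      obtain ⟨rfl, rfl⟩ := ih g
      obtain ⟨rfl, rfl⟩ := ih' g'
      exact ⟨rfl, rfl⟩
    | loop_false hx' => exact absurd hx' hx
  | loop_false hx =>
    cases h₂ with
    | loop_true hx' _ _ => exact absurd hx hx'
    | loop_false _ => exact ⟨rfl, rfl⟩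

/-- `f` as an array, padded with `d`. -/
def toArray {A : Type*} {k : ℕ} (d : A) (f : Fin k → A) (i : ℕ) : A :=
  if h : i < k then f ⟨i, h⟩ else d

/-- The initial memory. Integer array 0 holds the numbers of vertices and edges, arrays 1 and 2 the
two ends of each edge, arrays 3 and 4 the numerator and denominator (in lowest terms) of each
weight; group array 0 holds the labels. All other entries are zero. -/
def Input.memory {Γ : Type*} [AddCommGroup Γ] (I : Input Γ) : Memory Γ where
  int := fun a => match a with
    | 0 => toArray 0 ![(I.n : ℤ), (I.m : ℤ)]
    | 1 => toArray 0 fun e => (((I.ends e).1 : ℕ) : ℤ)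
    | 2 => toArray 0 fun e => (((I.ends e).2 : ℕ) : ℤ)
    | 3 => toArray 0 fun e => (I.weight e).num
    | 4 => toArray 0 fun e => ((I.weight e).den : ℤ)
    | _ => fun _ => 0
  grp := fun a => match a with
    | 0 => toArray 0 I.label
    | _ => fun _ => 0

/-- The memory `s` presents the edge set `F` as output: integer array 5 is the indicator vector
of `F`. -/
def Input.Outputs {Γ : Type*} (I : Input Γ) (s : Memory Γ) (F : Finset (Fin I.m)) : Prop :=
  ∀ e : Fin I.m, s.int 5 e = if e ∈ F then 1 else 0

end GammaGraphic

end

noncomputable section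

namespace GammaGraphic

section Connectivity

variable {V E : Type*} (ends : E → V × V)

/-- Two vertices are joined by an edge of `F`. -/
def Joins (F : Set E) (u v : V) : Prop :=
  ∃ e ∈ F, ends e = (u, v) ∨ ends e = (v, u)

/-- Two vertices are joined by a walk in `F`. -/
def Conn (F : Set E) : V → V → Prop :=
  Relation.ReflTransGen (Joins ends F)

/-- Every edge of `F` is a bridge of `F`. -/
def Acyc (F : Set E) : Prop :=
  ∀ e ∈ F, ¬ Conn ends (F \ {e}) (ends e).1 (ends e).2

variable {ends} {F A : Set E} {e : E} {u v w : V}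

theorem Joins.symm (h : Joins ends F u v) : Joins ends F v u := by
  obtain ⟨e, he, h⟩ := h
  exact ⟨e, he, h.symm⟩

theorem Conn.refl (u : V) : Conn ends F u u := Relation.ReflTransGen.refl

theorem Conn.trans (h : Conn ends F u v) (h' : Conn ends F v w) : Conn ends F u w :=
  Relation.ReflTransGen.trans h h'

theorem Conn.symm (h : Conn ends F u v) : Conn ends F v u := by
  induction h with
  | refl => exact Conn.refl _
  | tail _ h ih => exact Conn.trans (Relation.ReflTransGen.single h.symm) ih

theorem Conn.mono (hF : A ⊆ F) (h : Conn ends A u v) : Conn ends F u v :=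
  Relation.ReflTransGen.mono (fun _ _ ⟨e, he, h⟩ => ⟨e, hF he, h⟩) _ _ h

theorem conn_of_mem (he : e ∈ F) : Conn ends F (ends e).1 (ends e).2 :=
  Relation.ReflTransGen.single ⟨e, he, Or.inl rfl⟩

theorem conn_insert :
    Conn ends (insert e F) u v ↔ Conn ends F u v ∨
      (Conn ends F u (ends e).1 ∧ Conn ends F (ends e).2 v) ∨
      (Conn ends F u (ends e).2 ∧ Conn ends F (ends e).1 v) := by
  constructor
  · intro h
    induction h with
    | refl => exact Or.inl (Conn.refl _)
    | @tail x y _ h ih =>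
      obtain ⟨f, hf, h⟩ := h
      rcases hf with rfl | hf
      · rcases h with h | h <;> rw [h] at ih ⊢ <;> simp only at ih ⊢
        · rcases ih with h1 | ⟨h1, h2⟩ | ⟨h1, h2⟩
          · exact Or.inr (Or.inl ⟨h1, Conn.refl _⟩)
          · exact Or.inr (Or.inl ⟨h1, Conn.refl _⟩)
          · exact Or.inl h1
        · rcases ih with h1 | ⟨h1, h2⟩ | ⟨h1, h2⟩
          · exact Or.inr (Or.inr ⟨h1, Conn.refl _⟩)
          · exact Or.inl h1
          · exact Or.inr (Or.inr ⟨h1, Conn.refl _⟩)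
      · have hs : Conn ends F x y := Relation.ReflTransGen.single ⟨f, hf, h⟩
        rcases ih with h1 | ⟨h1, h2⟩ | ⟨h1, h2⟩
        · exact Or.inl (h1.trans hs)
        · exact Or.inr (Or.inl ⟨h1, h2.trans hs⟩)
        · exact Or.inr (Or.inr ⟨h1, h2.trans hs⟩)
  · have hsub : F ⊆ insert e F := Set.subset_insert _ _
    have he : Conn ends (insert e F) (ends e).1 (ends e).2 := conn_of_mem (Set.mem_insert _ _)
    rintro (h | ⟨h, h'⟩ | ⟨h, h'⟩)
    · exact h.mono hsub
    · exact ((h.mono hsub).trans he).trans (h'.mono hsub)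
    · exact ((h.mono hsub).trans he.symm).trans (h'.mono hsub)

theorem conn_insert_of_not (h1 : ¬ Conn ends F v (ends e).1) (h2 : ¬ Conn ends F v (ends e).2) :
    Conn ends (insert e F) v u ↔ Conn ends F v u := by
  rw [conn_insert]; tauto

theorem conn_empty : Conn ends ∅ u v ↔ u = v := by
  constructor
  · intro h
    induction h with
    | refl => rfl
    | tail _ h _ => obtain ⟨e, he, _⟩ := h; exact he.elim
  · rintro rfl; exact Conn.refl _

theorem Acyc.mono (h : Acyc ends F) (hA : A ⊆ F) : Acyc ends A :=
  fun e he hc => h e (hA he) (hc.mono (Set.sdiff_subset_sdiff_left hA))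

theorem acyc_empty : Acyc ends ∅ := fun _ he => he.elim

theorem acyc_insert (he : e ∉ F) :
    Acyc ends (insert e F) ↔ Acyc ends F ∧ ¬ Conn ends F (ends e).1 (ends e).2 := by
  constructor
  · intro h
    refine ⟨h.mono (Set.subset_insert _ _), fun hc => h e (Set.mem_insert _ _) ?_⟩
    rwa [Set.insert_sdiff_self_of_notMem he]
  · rintro ⟨h, hn⟩ f hf hc
    by_cases hfe : f = e
    · subst hfe
      rw [Set.insert_sdiff_self_of_notMem he] at hc
      exact hn hc
    · have hfF : f ∈ F := hf.resolve_left hfe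
      have hs : F \ {f} ⊆ F := Set.sdiff_subset
      have hcf : Conn ends F (ends f).1 (ends f).2 := conn_of_mem hfF
      rw [Set.insert_sdiff_of_notMem _ (by simpa using fun h => hfe h.symm), conn_insert] at hc
      rcases hc with hc | ⟨h1, h2⟩ | ⟨h1, h2⟩
      · exact h f hfF hc
      · exact hn (((h1.mono hs).symm.trans hcf).trans (h2.mono hs).symm)
      · exact hn (((h2.mono hs).trans hcf.symm).trans (h1.mono hs))

/-- Two vertices connected in an acyclic set and in each of its subsets obtained by removing one
edge of `S` remain connected when all of `S` is removed. -/
theorem Acyc.conn_diff (hF : Acyc ends F) {S : Set E} (hS : S.Finite) (hSF : S ⊆ F)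
    (h : Conn ends F u v) (hf : ∀ f ∈ S, Conn ends (F \ {f}) u v) : Conn ends (F \ S) u v := by
  induction S, hS using Set.Finite.induction_on with
  | empty => simpa using h
  | @insert f S hfS _ ih =>
    have ih := ih ((Set.subset_insert _ _).trans hSF) fun g hg => hf g (Or.inr hg)
    have hfF := hSF (Set.mem_insert f S)
    set A := F \ insert f S with hA
    have hins : F \ S = insert f A := by
      ext g
      simp only [hA, Set.mem_sdiff, Set.mem_insert_iff]
      by_cases hg : g = f
      · subst hg; simp [hfF, hfS]
      · simp [hg]
    have hAf : A ⊆ F \ {f} := fun g hg => ⟨hg.1, fun h => hg.2 (Or.inl h)⟩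
    have huv := hf f (Set.mem_insert _ _)
    rw [hins, conn_insert] at ih
    rcases ih with ih | ⟨h1, h2⟩ | ⟨h1, h2⟩
    · exact ih
    · exact (hF f hfF (((h1.mono hAf).symm.trans huv).trans (h2.mono hAf).symm)).elim
    · exact (hF f hfF (((h2.mono hAf).trans huv.symm).trans (h1.mono hAf))).elim

end Connectivity

section ClassSums

open Classical in
/-- The sum of the labels over the vertices connected to `v` in `F`. -/
def classSum {V E Γ : Type*} [Fintype V] [AddCommGroup Γ] (ends : E → V × V) (γ : V → Γ)
    (F : Set E) (v : V) : Γ :=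
  ∑ u with Conn ends F v u, γ u

/-- `F` is acyclic and all its components have nonzero sum. -/
def Feas {V E Γ : Type*} [Fintype V] [AddCommGroup Γ] (ends : E → V × V) (γ : V → Γ)
    (F : Set E) : Prop :=
  Acyc ends F ∧ ∀ v, classSum ends γ F v ≠ 0

variable {V E Γ : Type*} [Fintype V] [AddCommGroup Γ] {ends : E → V × V} {γ : V → Γ}
  {F A : Set E} {e : E} {u v : V}

theorem classSum_eq_of_iff (h : ∀ w, Conn ends F u w ↔ Conn ends A v w) :
    classSum ends γ F u = classSum ends γ A v := by
  unfold classSum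
  exact Finset.sum_congr (by ext w; simp [h]) fun _ _ => rfl

theorem classSum_congr (h : Conn ends F u v) : classSum ends γ F u = classSum ends γ F v :=
  classSum_eq_of_iff fun _ => ⟨fun h' => h.symm.trans h', fun h' => h.trans h'⟩

theorem classSum_insert_of_not (h1 : ¬ Conn ends F v (ends e).1)
    (h2 : ¬ Conn ends F v (ends e).2) :
    classSum ends γ (insert e F) v = classSum ends γ F v :=
  classSum_eq_of_iff fun _ => conn_insert_of_not h1 h2

theorem classSum_insert (h : ¬ Conn ends F (ends e).1 (ends e).2) :
    classSum ends γ (insert e F) (ends e).1 =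
      classSum ends γ F (ends e).1 + classSum ends γ F (ends e).2 := by
  classical
  unfold classSum
  rw [← Finset.sum_union]
  · refine Finset.sum_congr ?_ fun _ _ => rfl
    ext w
    simp only [Finset.mem_filter, Finset.mem_univ, true_and, Finset.mem_union, conn_insert]
    have : Conn ends F (ends e).1 (ends e).1 := Conn.refl _
    tauto
  · rw [Finset.disjoint_left]
    intro w hw hw'
    simp only [Finset.mem_filter, Finset.mem_univ, true_and] at hw hw'
    exact h (hw.trans hw'.symm)

/-- A union of components with sum zero has sum zero. -/
theorem sum_eq_zero_of_closed (U : Finset V)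
    (hU : ∀ u ∈ U, ∀ v, Conn ends F u v → v ∈ U)
    (h0 : ∀ u ∈ U, classSum ends γ F u = 0) : ∑ u ∈ U, γ u = 0 := by
  classical
  let R : Setoid V := ⟨Conn ends F, fun u => Conn.refl u, Conn.symm, Conn.trans⟩
  rw [Finset.sum_partition R]
  refine Finset.sum_eq_zero fun q hq => ?_
  obtain ⟨u, hu, rfl⟩ := Finset.mem_image.mp hq
  rw [← h0 u hu]
  refine Finset.sum_congr ?_ fun _ _ => rfl
  ext w
  simp only [Finset.mem_filter, Finset.mem_univ, true_and]
  constructor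
  · rintro ⟨_, h⟩
    exact Conn.symm (Quotient.exact h)
  · intro h
    exact ⟨hU u hu w h, Quotient.sound (Conn.symm h)⟩

theorem exists_classSum_ne_zero (hA : A ⊆ F) (h : classSum ends γ F v ≠ 0) :
    ∃ u, Conn ends F v u ∧ classSum ends γ A u ≠ 0 := by
  classical
  by_contra! hc
  refine h (sum_eq_zero_of_closed (ends := ends) (F := A) _ ?_ ?_)
  · intro u hu w hw
    simp only [Finset.mem_filter, Finset.mem_univ, true_and] at hu ⊢
    exact hu.trans (hw.mono hA)
  · intro u hu
    simp only [Finset.mem_filter, Finset.mem_univ, true_and] at hu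
    exact hc u hu

/-- Adding an edge that joins two components to an acyclic set, when the union of the two
components has nonzero sum. -/
theorem Feas.insert_of (hF : Acyc ends F) (hn : ¬ Conn ends F (ends e).1 (ends e).2)
    (hs : classSum ends γ F (ends e).1 + classSum ends γ F (ends e).2 ≠ 0)
    (ho : ∀ v, ¬ Conn ends F v (ends e).1 → ¬ Conn ends F v (ends e).2 →
      classSum ends γ F v ≠ 0) :
    Feas ends γ (insert e F) := by
  have he : e ∉ F := fun he => hn (conn_of_mem he)
  refine ⟨(acyc_insert he).2 ⟨hF, hn⟩, fun v => ?_⟩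
  have key : Conn ends (insert e F) v (ends e).1 → classSum ends γ (insert e F) v ≠ 0 := by
    intro h
    rw [classSum_congr h, classSum_insert hn]
    exact hs
  by_cases h1 : Conn ends F v (ends e).1
  · exact key (h1.mono (Set.subset_insert _ _))
  by_cases h2 : Conn ends F v (ends e).2
  · exact key ((h2.mono (Set.subset_insert _ _)).trans (conn_of_mem (Set.mem_insert _ _)).symm)
  rw [classSum_insert_of_not h1 h2]
  exact ho v h1 h2

/-- Removing an edge from an acyclic set, when both parts of its component have nonzero sum. -/
theorem Feas.diff_of (hF : Acyc ends F) (he : e ∈ F)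
    (h1 : classSum ends γ (F \ {e}) (ends e).1 ≠ 0)
    (h2 : classSum ends γ (F \ {e}) (ends e).2 ≠ 0)
    (ho : ∀ v, ¬ Conn ends F v (ends e).1 → classSum ends γ F v ≠ 0) :
    Feas ends γ (F \ {e}) := by
  refine ⟨hF.mono Set.sdiff_subset, fun v => ?_⟩
  by_cases hv1 : Conn ends (F \ {e}) v (ends e).1
  · rwa [classSum_congr hv1]
  by_cases hv2 : Conn ends (F \ {e}) v (ends e).2
  · rwa [classSum_congr hv2]
  have hi : insert e (F \ {e}) = F := Set.insert_sdiff_self_of_mem he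
  rw [← classSum_insert_of_not (γ := γ) hv1 hv2, hi]
  refine ho v fun h => ?_
  rw [← hi, conn_insert_of_not hv1 hv2] at h
  exact hv1 h

/-- An acyclic set with exactly one component of sum zero can be made feasible by one step towards
any given feasible set. -/
theorem exists_repair [Finite E] {F₁ F' : Set E} (hF₁ : Acyc ends F₁) (hF' : Feas ends γ F') (b : V)
    (hb : classSum ends γ F₁ b = 0)
    (ho : ∀ v, ¬ Conn ends F₁ b v → classSum ends γ F₁ v ≠ 0) :
    ∃ f, (f ∈ F' ∧ f ∉ F₁ ∧ Feas ends γ (insert f F₁)) ∨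
      (f ∈ F₁ ∧ f ∉ F' ∧ Feas ends γ (F₁ \ {f})) := by
  classical
  by_cases hout : ∃ f ∈ F', ¬ (Conn ends F₁ b (ends f).1 ↔ Conn ends F₁ b (ends f).2)
  · obtain ⟨f, hfF', hf⟩ := hout
    have hn : ¬ Conn ends F₁ (ends f).1 (ends f).2 := fun h =>
      hf ⟨fun h' => h'.trans h, fun h' => h'.trans h.symm⟩
    refine ⟨f, Or.inl ⟨hfF', fun h => hn (conn_of_mem h), Feas.insert_of hF₁ hn ?_ ?_⟩⟩
    · by_cases h1 : Conn ends F₁ b (ends f).1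
      · rw [← classSum_congr h1, hb, zero_add]
        exact ho _ fun h2 => hf ⟨fun _ => h2, fun _ => h1⟩
      · have h2 : Conn ends F₁ b (ends f).2 := by tauto
        rw [← classSum_congr h2, hb, add_zero]
        exact ho _ h1
    · intro v h1 h2
      refine ho v fun h => ?_
      by_cases hb1 : Conn ends F₁ b (ends f).1
      · exact h1 (h.symm.trans hb1)
      · have hb2 : Conn ends F₁ b (ends f).2 := by tauto
        exact h2 (h.symm.trans hb2)
  push Not at hout
  have hclosed : ∀ u v, Conn ends F₁ b u → Conn ends F' u v → Conn ends F₁ b v := by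
    intro u v hu h
    induction h with
    | refl => exact hu
    | tail _ h ih =>
      obtain ⟨f, hf, h⟩ := h
      have := hout f hf
      rcases h with h | h <;> rw [h] at this
      · exact this.1 ih
      · exact this.2 ih
  by_contra! hc
  have hsplit : ∀ f ∈ F₁, f ∉ F' → Conn ends F₁ b (ends f).1 →
      classSum ends γ (F₁ \ {f}) (ends f).1 = 0 := by
    intro f hf hf' hfb
    by_contra h1
    have hsum := classSum_insert (γ := γ) (hF₁ f hf)
    rw [Set.insert_sdiff_self_of_mem hf, ← classSum_congr hfb, hb] at hsum
    refine (hc f).2 hf hf' (Feas.diff_of hF₁ hf h1 (fun h2 => h1 ?_) ?_)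
    · rw [h2, add_zero] at hsum
      exact hsum.symm
    · exact fun v hv => ho v fun h => hv (h.symm.trans hfb)
  have hzero : ∀ S : Set E, S.Finite → S ⊆ F₁ \ F' →
      ∀ v, Conn ends F₁ b v → classSum ends γ (F₁ \ S) v = 0 := by
    intro S hS
    induction S, hS using Set.Finite.induction_on with
    | empty =>
      intro _ v hv
      rw [Set.sdiff_empty, ← classSum_congr hv, hb]
    | @insert f S hfS _ ih =>
      intro hsub v hv
      have ih := ih ((Set.subset_insert _ _).trans hsub)
      obtain ⟨hf, hf'⟩ := hsub (Set.mem_insert _ _)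
      set A := F₁ \ insert f S with hA
      have hins : F₁ \ S = insert f A := by
        ext g
        simp only [hA, Set.mem_sdiff, Set.mem_insert_iff]
        by_cases hg : g = f
        · subst hg; simp [hf, hfS]
        · simp [hg]
      have hAf : A ⊆ F₁ \ {f} := fun g hg => ⟨hg.1, fun h => hg.2 (Or.inl h)⟩
      have hAF : A ⊆ F₁ := Set.sdiff_subset
      rw [hins] at ih
      have hother : ∀ u, Conn ends F₁ b u → ¬ Conn ends A u (ends f).1 →
          ¬ Conn ends A u (ends f).2 → classSum ends γ A u = 0 := by
        intro u hu h1 h2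
        rw [← classSum_insert_of_not h1 h2]
        exact ih u hu
      have hnA : ¬ Conn ends A (ends f).1 (ends f).2 := fun h => hF₁ f hf (h.mono hAf)
      have hfirst : Conn ends F₁ b (ends f).1 → classSum ends γ A (ends f).1 = 0 := by
        intro hfb
        refine Eq.trans ?_ (hsplit f hf hf' hfb)
        unfold classSum
        rw [← Finset.sum_sdiff (s₁ := Finset.univ.filter (Conn ends A (ends f).1))
          (s₂ := Finset.univ.filter (Conn ends (F₁ \ {f}) (ends f).1))]
        · refine ((congrArg (· + _) (sum_eq_zero_of_closed (ends := ends) (F := A) _ ?_ ?_)).trans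
            (zero_add _)).symm
          · intro u hu w huw
            simp only [Finset.mem_sdiff, Finset.mem_filter, Finset.mem_univ, true_and] at hu ⊢
            exact ⟨hu.1.trans (huw.mono hAf), fun h => hu.2 (h.trans huw.symm)⟩
          · intro u hu
            simp only [Finset.mem_sdiff, Finset.mem_filter, Finset.mem_univ, true_and] at hu
            refine hother u (hfb.trans (hu.1.mono Set.sdiff_subset)) (fun h => hu.2 h.symm) ?_
            exact fun h => hF₁ f hf (hu.1.trans (h.mono hAf))
        · intro w hw
          simp only [Finset.mem_filter, Finset.mem_univ, true_and] at hw ⊢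
          exact hw.mono hAf
      by_cases h1 : Conn ends A v (ends f).1
      · rw [classSum_congr h1]
        exact hfirst (hv.trans (h1.mono hAF))
      by_cases h2 : Conn ends A v (ends f).2
      · have hfb : Conn ends F₁ b (ends f).1 :=
          (hv.trans (h2.mono hAF)).trans (conn_of_mem hf).symm
        have := classSum_insert (γ := γ) hnA
        rw [ih _ hfb, hfirst hfb, zero_add] at this
        rw [classSum_congr h2, ← this]
      · exact hother v hv h1 h2
  obtain ⟨u, hu, hu'⟩ := exists_classSum_ne_zero (A := F₁ \ (F₁ \ F'))
    (fun g hg => by_contra fun h => hg.2 ⟨hg.1, h⟩) (hF'.2 b)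
  exact hu' (hzero _ (Set.toFinite _) subset_rfl u (hclosed b u (Conn.refl _) hu))

/-- The symmetric exchange property, for an element to be added. -/
theorem Feas.exchange_insert [Finite E] {F' : Set E} (hF : Feas ends γ F) (hF' : Feas ends γ F')
    (he : e ∉ F) (he' : e ∈ F') :
    Feas ends γ (insert e F) ∨
      (∃ f ∈ F', f ∉ F ∧ f ≠ e ∧ Feas ends γ (insert f (insert e F))) ∨
      (∃ f ∈ F, f ∉ F' ∧ Feas ends γ (insert e F \ {f})) := by
  by_cases hc : Conn ends F (ends e).1 (ends e).2
  · right; right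
    obtain ⟨f, ⟨hfF, hfF'⟩, hf⟩ :
        ∃ f ∈ F \ F', ¬ Conn ends (F \ {f}) (ends e).1 (ends e).2 := by
      by_contra! h
      have := hF.1.conn_diff (Set.toFinite _) Set.sdiff_subset hc h
      exact hF'.1 e he' (this.mono fun g hg =>
        ⟨by_contra fun h => hg.2 ⟨hg.1, h⟩, fun h => he (h ▸ hg.1)⟩)
    have hfe : f ≠ e := fun h => he (h ▸ hfF)
    have hr : insert e F \ {f} = insert e (F \ {f}) :=
      Set.insert_sdiff_of_notMem _ fun h => hfe h.symm
    have hi : insert f (F \ {f}) = F := Set.insert_sdiff_self_of_mem hfF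
    refine ⟨f, hfF, hfF', ?_⟩
    rw [hr]
    refine ⟨(acyc_insert fun h => he h.1).2 ⟨hF.1.mono Set.sdiff_subset, hf⟩, fun v => ?_⟩
    rw [classSum_eq_of_iff (A := F) (v := v) fun w => ?_]
    · exact hF.2 v
    have hsame : Conn ends (insert e (F \ {f})) (ends f).1 (ends f).2 := by
      rw [← hi, conn_insert] at hc
      rw [conn_insert]
      rcases hc with hc | ⟨h1, h2⟩ | ⟨h1, h2⟩
      · exact (hf hc).elim
      · exact Or.inr (Or.inl ⟨h1.symm, h2.symm⟩)
      · exact Or.inr (Or.inr ⟨h2, h1⟩)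
    have hs := Set.subset_insert e (F \ {f})
    constructor
    · intro h
      rcases conn_insert.1 h with h | ⟨h1, h2⟩ | ⟨h1, h2⟩
      · exact h.mono Set.sdiff_subset
      · exact ((h1.mono Set.sdiff_subset).trans hc).trans (h2.mono Set.sdiff_subset)
      · exact ((h1.mono Set.sdiff_subset).trans hc.symm).trans (h2.mono Set.sdiff_subset)
    · intro h
      rw [← hi] at h
      rcases conn_insert.1 h with h | ⟨h1, h2⟩ | ⟨h1, h2⟩
      · exact h.mono hs
      · exact ((h1.mono hs).trans hsame).trans (h2.mono hs)
      · exact ((h1.mono hs).trans hsame.symm).trans (h2.mono hs)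
  by_cases hs : classSum ends γ F (ends e).1 + classSum ends γ F (ends e).2 = 0
  · right
    have he1 : Conn ends (insert e F) (ends e).1 (ends e).2 := conn_of_mem (Set.mem_insert _ _)
    obtain ⟨f, ⟨h1, h2, h3⟩ | ⟨h1, h2, h3⟩⟩ := exists_repair (F₁ := insert e F)
      ((acyc_insert he).2 ⟨hF.1, hc⟩) hF' (ends e).1 (by rw [classSum_insert hc, hs]) (by
        intro v hv
        rw [classSum_insert_of_not]
        · exact hF.2 v
        · exact fun h => hv (h.mono (Set.subset_insert _ _)).symm
        · exact fun h => hv (he1.trans (h.mono (Set.subset_insert _ _)).symm))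
    · exact Or.inl ⟨f, h1, fun h => h2 (Or.inr h), fun h => h2 (Or.inl h), h3⟩
    · exact Or.inr ⟨f, h1.resolve_left fun h => h2 (h ▸ he'), h2, h3⟩
  · exact Or.inl (Feas.insert_of hF.1 hc hs fun v _ _ => hF.2 v)

/-- The symmetric exchange property, for an element to be removed. -/
theorem Feas.exchange_diff [Finite E] {F' : Set E} (hF : Feas ends γ F) (hF' : Feas ends γ F')
    (he : e ∈ F) (he' : e ∉ F') :
    Feas ends γ (F \ {e}) ∨
      (∃ f ∈ F', f ∉ F ∧ Feas ends γ (insert f (F \ {e}))) ∨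
      (∃ f ∈ F, f ∉ F' ∧ f ≠ e ∧ Feas ends γ ((F \ {e}) \ {f})) := by
  have hac : Acyc ends (F \ {e}) := hF.1.mono Set.sdiff_subset
  have hn := hF.1 e he
  have hi : insert e (F \ {e}) = F := Set.insert_sdiff_self_of_mem he
  have hsum := classSum_insert (γ := γ) hn
  rw [hi] at hsum
  have hne := hF.2 (ends e).1
  have key : ∀ b, (b = (ends e).1 ∨ b = (ends e).2) → classSum ends γ (F \ {e}) b = 0 →
      (∃ f ∈ F', f ∉ F ∧ Feas ends γ (insert f (F \ {e}))) ∨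
      (∃ f ∈ F, f ∉ F' ∧ f ≠ e ∧ Feas ends γ ((F \ {e}) \ {f})) := by
    intro b hb hb0
    obtain ⟨f, ⟨h1, h2, h3⟩ | ⟨h1, h2, h3⟩⟩ := exists_repair hac hF' b hb0 (by
      intro v hv
      by_cases h1 : Conn ends (F \ {e}) v (ends e).1
      · rw [classSum_congr h1]
        rcases hb with rfl | rfl
        · exact (hv h1.symm).elim
        · rwa [hsum, hb0, add_zero] at hne
      by_cases h2 : Conn ends (F \ {e}) v (ends e).2
      · rw [classSum_congr h2]
        rcases hb with rfl | rfl
        · rwa [hsum, hb0, zero_add] at hne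
        · exact (hv h2.symm).elim
      rw [← classSum_insert_of_not h1 h2, hi]
      exact hF.2 v)
    · exact Or.inl ⟨f, h1, fun h => h2 ⟨h, fun h' => he' (h' ▸ h1)⟩, h3⟩
    · exact Or.inr ⟨f, h1.1, h2, h1.2, h3⟩
  by_cases h1 : classSum ends γ (F \ {e}) (ends e).1 = 0
  · exact Or.inr (key _ (Or.inl rfl) h1)
  by_cases h2 : classSum ends γ (F \ {e}) (ends e).2 = 0
  · exact Or.inr (key _ (Or.inr rfl) h2)
  exact Or.inl (Feas.diff_of hF.1 he h1 h2 fun v _ => hF.2 v)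

/-- The condition under which some feasible set lies between `X` and `Z`. -/
def Separable (ends : E → V × V) (γ : V → Γ) (X Z : Set E) : Prop :=
  Acyc ends X ∧ ∀ v, ∃ u, Conn ends Z v u ∧ classSum ends γ X u ≠ 0

theorem Feas.separable {X Z : Set E} (hF : Feas ends γ F) (hX : X ⊆ F) (hZ : F ⊆ Z) :
    Separable ends γ X Z := by
  refine ⟨hF.1.mono hX, fun v => ?_⟩
  obtain ⟨u, hu, h⟩ := exists_classSum_ne_zero hX (hF.2 v)
  exact ⟨u, hu.mono hZ, h⟩

theorem Separable.exists_feas {X Z : Set E} (h : Separable ends γ X Z) (hXZ : X ⊆ Z) :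
    ∃ F, X ⊆ F ∧ F ⊆ Z ∧ Feas ends γ F := by
  classical
  induction hk : (Finset.univ.filter fun v => classSum ends γ X v = 0).card
    using Nat.strong_induction_on generalizing X with
  | _ k ih =>
    by_cases h0 : ∀ v, classSum ends γ X v ≠ 0
    · exact ⟨X, subset_rfl, hXZ, h.1, h0⟩
    push Not at h0
    obtain ⟨v, hv⟩ := h0
    obtain ⟨u, hvu, hu⟩ := h.2 v
    obtain ⟨e, heZ, hne⟩ : ∃ e ∈ Z, ¬ (classSum ends γ X (ends e).1 = 0 ↔
        classSum ends γ X (ends e).2 = 0) := by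
      by_contra! hc
      have : classSum ends γ X u = 0 := by
        clear hu
        induction hvu with
        | refl => exact hv
        | tail _ hj ih =>
          obtain ⟨e, he, hj⟩ := hj
          have := hc e he
          rcases hj with hj | hj <;> rw [hj] at this
          · exact this.1 ih
          · exact this.2 ih
      exact hu this
    have hn : ¬ Conn ends X (ends e).1 (ends e).2 := fun hc => hne (by rw [classSum_congr hc])
    have heX : e ∉ X := fun h => hn (conn_of_mem h)
    have hmerge : ∀ w, Conn ends (insert e X) w (ends e).1 →
        classSum ends γ (insert e X) w ≠ 0 := by
      intro w hw
      rw [classSum_congr hw, classSum_insert hn]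
      by_cases h1 : classSum ends γ X (ends e).1 = 0
      · rw [h1, zero_add]; tauto
      · have h2 : classSum ends γ X (ends e).2 = 0 := by tauto
        rwa [h2, add_zero]
    have hmem : Conn ends (insert e X) (ends e).1 (ends e).2 := conn_of_mem (Set.mem_insert _ _)
    have hs := Set.subset_insert e X
    have hkeep : ∀ w, classSum ends γ X w ≠ 0 → classSum ends γ (insert e X) w ≠ 0 := by
      intro w hw
      by_cases h1 : Conn ends X w (ends e).1
      · exact hmerge w (h1.mono hs)
      by_cases h2 : Conn ends X w (ends e).2
      · exact hmerge w ((h2.mono hs).trans hmem.symm)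
      rwa [classSum_insert_of_not h1 h2]
    obtain ⟨F, hF1, hF2, hF3⟩ := ih _ (by
      rw [← hk]
      refine Finset.card_lt_card (Finset.ssubset_iff_of_subset ?_ |>.2 ?_)
      · intro w hw
        simp only [Finset.mem_filter, Finset.mem_univ, true_and] at hw ⊢
        by_contra hw'
        exact hkeep w hw' hw
      · by_cases h1 : classSum ends γ X (ends e).1 = 0
        · exact ⟨(ends e).1, by simpa using h1, by simpa using hmerge _ (Conn.refl _)⟩
        · have h2 : classSum ends γ X (ends e).2 = 0 := by tauto
          exact ⟨(ends e).2, by simpa using h2, by simpa using hmerge _ hmem.symm⟩)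
      (X := insert e X)
      ⟨(acyc_insert heX).2 ⟨h.1, hn⟩, fun w => by
        obtain ⟨u, h1, h2⟩ := h.2 w
        exact ⟨u, h1, hkeep u h2⟩⟩
      (Set.insert_subset heZ hXZ) rfl
    exact ⟨F, hs.trans hF1, hF2, hF3⟩

end ClassSums

section Greedy

open Classical in
/-- The total weight of an edge set. -/
def totalWeight {E : Type*} [Fintype E] (w : E → ℚ) (F : Set E) : ℚ :=
  ∑ e with e ∈ F, w e

theorem totalWeight_insert {E : Type*} [Fintype E] {w : E → ℚ} {F : Set E} {e : E} (he : e ∉ F) :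
    totalWeight w (insert e F) = totalWeight w F + w e := by
  classical
  unfold totalWeight
  rw [add_comm, ← Finset.sum_insert (by simpa using he)]
  exact Finset.sum_congr (by ext; simp) fun _ _ => rfl

theorem totalWeight_sdiff {E : Type*} [Fintype E] {w : E → ℚ} {F : Set E} {e : E} (he : e ∈ F) :
    totalWeight w (F \ {e}) = totalWeight w F - w e := by
  rw [eq_sub_iff_add_eq, ← totalWeight_insert fun h => h.2 rfl, Set.insert_sdiff_self_of_mem he]

/-- Some feasible set of maximum weight lies between `X` and `Z`. -/
def Extendable {V E Γ : Type*} [Fintype V] [Fintype E] [AddCommGroup Γ] (ends : E → V × V)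
    (γ : V → Γ) (w : E → ℚ) (X Z : Set E) : Prop :=
  ∃ F, X ⊆ F ∧ F ⊆ Z ∧ Feas ends γ F ∧
    ∀ F', Feas ends γ F' → totalWeight w F' ≤ totalWeight w F

variable {V E Γ : Type*} [Fintype V] [Fintype E] [AddCommGroup Γ] {ends : E → V × V}
  {γ : V → Γ} {w : E → ℚ} {X Z : Set E} {e : E}

theorem Separable.extendable (h : Separable ends γ ∅ Set.univ) :
    Extendable ends γ w ∅ Set.univ := by
  obtain ⟨F₀, -, -, hF₀⟩ := h.exists_feas (Set.subset_univ _)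
  obtain ⟨F, hF, hmax⟩ := Set.exists_max_image {F | Feas ends γ F} (totalWeight w)
    (Set.toFinite _) ⟨F₀, hF₀⟩
  exact ⟨F, Set.empty_subset _, Set.subset_univ _, hF, hmax⟩

theorem Extendable.insert_edge (h : Extendable ends γ w X Z) (heZ : e ∈ Z) (hw : 0 ≤ w e)
    (hmax : ∀ f ∈ Z, f ∉ X → |w f| ≤ |w e|) (hs : Separable ends γ (insert e X) Z) :
    Extendable ends γ w (insert e X) Z := by
  obtain ⟨F, hXF, hFZ, hF, hopt⟩ := h
  by_cases heF : e ∈ F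
  · exact ⟨F, Set.insert_subset heF hXF, hFZ, hF, hopt⟩
  have hXZ := hXF.trans hFZ
  obtain ⟨F', hXF', hFZ', hF'⟩ := hs.exists_feas (Set.insert_subset heZ hXZ)
  rw [abs_of_nonneg hw] at hmax
  rcases hF.exchange_insert hF' heF (hXF' (Set.mem_insert _ _)) with
    h | ⟨f, hf', hf, hfe, h⟩ | ⟨f, hf, hf', h⟩
  · refine ⟨_, Set.insert_subset_insert hXF, Set.insert_subset heZ hFZ, h, fun A hA => ?_⟩
    have := hopt A hA
    rw [totalWeight_insert heF]; linarith
  · refine ⟨_, (Set.insert_subset_insert hXF).trans (Set.subset_insert _ _),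
      Set.insert_subset (hFZ' hf') (Set.insert_subset heZ hFZ), h, fun A hA => ?_⟩
    have := hopt A hA
    have := hmax f (hFZ' hf') fun h => hf (hXF h)
    have := neg_abs_le (w f)
    rw [totalWeight_insert (by simp [hf, hfe]), totalWeight_insert heF]; linarith
  · have hfX : f ∉ insert e X := fun h => hf' (hXF' h)
    refine ⟨insert e F \ {f}, fun g hg => ⟨Set.insert_subset_insert hXF hg, fun h => hfX (h ▸ hg)⟩,
      Set.sdiff_subset.trans (Set.insert_subset heZ hFZ), h, fun A hA => ?_⟩
    have := hopt A hA
    have := hmax f (hFZ hf) fun h => hfX (Or.inr h)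
    have := le_abs_self (w f)
    rw [totalWeight_sdiff (Set.mem_insert_of_mem _ hf), totalWeight_insert heF]; linarith

theorem Extendable.sdiff_edge (h : Extendable ends γ w X Z) (heX : e ∉ X) (hw : w e < 0)
    (hmax : ∀ f ∈ Z, f ∉ X → |w f| ≤ |w e|) (hs : Separable ends γ X (Z \ {e})) :
    Extendable ends γ w X (Z \ {e}) := by
  obtain ⟨F, hXF, hFZ, hF, hopt⟩ := h
  by_cases heF : e ∉ F
  · exact ⟨F, hXF, fun g hg => ⟨hFZ hg, fun h => heF (h ▸ hg)⟩, hF, hopt⟩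
  push Not at heF
  have hXZ := hXF.trans hFZ
  have hXe : X ⊆ Z \ {e} := fun g hg => ⟨hXZ hg, fun h => heX (h ▸ hg)⟩
  obtain ⟨F', hXF', hFZ', hF'⟩ := hs.exists_feas hXe
  rw [abs_of_neg hw] at hmax
  have hsub : F \ {e} ⊆ Z \ {e} := Set.sdiff_subset_sdiff_left hFZ
  have hsup : X ⊆ F \ {e} := fun g hg => ⟨hXF hg, fun h => heX (h ▸ hg)⟩
  rcases hF.exchange_diff hF' heF (fun h => (hFZ' h).2 rfl) with
    h | ⟨f, hf', hf, h⟩ | ⟨f, hf, hf', hfe, h⟩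
  · refine ⟨F \ {e}, hsup, hsub, h, fun A hA => ?_⟩
    have := hopt A hA
    rw [totalWeight_sdiff heF]; linarith
  · refine ⟨_, hsup.trans (Set.subset_insert _ _),
      Set.insert_subset (hFZ' hf') hsub, h, fun A hA => ?_⟩
    have := hopt A hA
    have := hmax f (hFZ' hf').1 fun h => hf (hXF h)
    have := neg_abs_le (w f)
    rw [totalWeight_insert (F := F \ {e}) (fun h => hf h.1), totalWeight_sdiff heF]; linarith
  · have hfX : f ∉ X := fun h => hf' (hXF' h)
    refine ⟨(F \ {e}) \ {f}, fun g hg => ⟨hsup hg, fun h => hfX (h ▸ hg)⟩,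
      Set.sdiff_subset.trans hsub, h, fun A hA => ?_⟩
    have := hopt A hA
    have := hmax f (hFZ hf) hfX
    have := le_abs_self (w f)
    rw [totalWeight_sdiff (F := F \ {e}) ⟨hf, hfe⟩, totalWeight_sdiff heF]; linarith

theorem Extendable.sdiff_of_not (h : Extendable ends γ w X Z)
    (hs : ¬ Separable ends γ (insert e X) Z) : Extendable ends γ w X (Z \ {e}) := by
  obtain ⟨F, hXF, hFZ, hF, hopt⟩ := h
  refine ⟨F, hXF, fun g hg => ⟨hFZ hg, ?_⟩, hF, hopt⟩
  rintro rfl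
  exact hs (hF.separable (Set.insert_subset hg hXF) hFZ)

theorem Extendable.insert_of_not (h : Extendable ends γ w X Z)
    (hs : ¬ Separable ends γ X (Z \ {e})) : Extendable ends γ w (insert e X) Z := by
  obtain ⟨F, hXF, hFZ, hF, hopt⟩ := h
  refine ⟨F, Set.insert_subset ?_ hXF, hFZ, hF, hopt⟩
  by_contra he
  exact hs (hF.separable hXF fun g hg => ⟨hFZ hg, fun h => he (h ▸ hg)⟩)

end Greedy

section Translation

variable {Γ : Type*} (I : Input Γ)

theorem Input.adj_iff {u v : Fin I.n} : I.graph.Adj u v ↔ Joins I.ends Set.univ u v :=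
  ⟨fun ⟨e, h⟩ => ⟨e, trivial, h⟩, fun ⟨e, _, h⟩ => ⟨e, h⟩⟩

theorem Input.vertexSet_component_restrict (F : Set (Fin I.m)) (x : Fin I.n) :
    (component (I.graph.restrict F) x).vertexSet = {y | Conn I.ends F x y} := rfl

theorem Input.vertexSet_component (x : Fin I.n) :
    (component I.graph x).vertexSet = {y | Conn I.ends Set.univ x y} := by
  have : I.graph.Adj = Joins I.ends Set.univ := by
    ext u v; exact I.adj_iff
  unfold component Conn
  rw [this]
  rfl

theorem Input.isAcyclicSet_iff (F : Set (Fin I.m)) :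
    IsAcyclicSet I.graph F ↔ Acyc I.ends F := by
  constructor
  · intro h e he hc
    refine h ?_
    by_cases hab : (I.ends e).1 = (I.ends e).2
    · refine ⟨0, fun _ => (I.ends e).1, fun _ => e, ?_, ?_, fun i => ⟨he, Or.inl ?_⟩⟩
      · exact fun i j _ => Fin.ext (by omega)
      · exact fun i j _ => Fin.ext (by omega)
      · exact Prod.ext rfl hab.symm
    let H : SimpleGraph (Fin I.n) :=
      { Adj := fun u v => u ≠ v ∧ Joins I.ends (F \ {e}) u v
        symm := ⟨fun _ _ h => ⟨h.1.symm, h.2.symm⟩⟩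
        loopless := ⟨fun _ h => h.1 rfl⟩ }
    have hreach : H.Reachable (I.ends e).1 (I.ends e).2 := by
      clear hab
      generalize (I.ends e).2 = b at hc
      induction hc with
      | refl => rfl
      | @tail x y _ hj ih =>
        by_cases hxy : x = y
        · exact hxy ▸ ih
        · exact ih.trans (SimpleGraph.Adj.reachable (G := H) ⟨hxy, hj⟩)
    obtain ⟨p, hp⟩ := hreach.exists_isPath
    have hadj : ∀ i, i < p.length → Joins I.ends (F \ {e}) (p.getVert i) (p.getVert (i + 1)) :=
      fun i hi => (p.adj_getVert_succ hi).2
    choose g hg hl using hadj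
    refine ⟨p.length, fun i => p.getVert i,
      fun i => if h : (i : ℕ) < p.length then g i h else e, ?_, ?_, ?_⟩
    · intro i j hij
      exact Fin.ext (hp.getVert_injOn (Nat.lt_succ_iff.1 i.2) (Nat.lt_succ_iff.1 j.2) hij)
    · intro i j hij
      have hinj : ∀ a b, a ≤ p.length → b ≤ p.length → p.getVert a = p.getVert b → a = b :=
        fun a b ha hb h => hp.getVert_injOn ha hb h
      have hi := i.2
      have hj := j.2
      simp only at hij
      split_ifs at hij with h1 h2 h2
      · have l1 := hl i h1
        have l2 := hl j h2
        rw [hij] at l1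
        apply Fin.ext
        rcases l1 with l1 | l1 <;> rcases l2 with l2 | l2 <;> rw [l1, Prod.mk.injEq] at l2
        · exact hinj _ _ h1.le h2.le l2.1
        · have := hinj _ _ h1.le h2 l2.1
          have := hinj _ _ h1 h2.le l2.2
          omega
        · have := hinj _ _ h1.le h2 l2.2
          have := hinj _ _ h1 h2.le l2.1
          omega
        · exact hinj _ _ h1.le h2.le l2.2
      · exact ((hg i h1).2 hij).elim
      · exact ((hg j h2).2 hij.symm).elim
      · exact Fin.ext (by omega)
    · intro i
      by_cases hi : (i : ℕ) < p.length
      · have : ((i + 1 : Fin (p.length + 1)) : ℕ) = i + 1 := by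
          rw [Fin.val_add_one_of_lt]
          exact Fin.lt_def.2 (by simpa using hi)
        simp only [hi, dite_true, this]
        exact ⟨(hg i hi).1, hl i hi⟩
      · have hlast : i = Fin.last _ := Fin.ext (by have := i.2; simp; omega)
        subst hlast
        simp only [Fin.val_last, lt_irrefl, dite_false, Fin.last_add_one, Fin.val_zero,
          SimpleGraph.Walk.getVert_zero, SimpleGraph.Walk.getVert_length]
        exact ⟨he, Or.inr rfl⟩
  · rintro h ⟨k, v, e, hv, he, hl⟩
    have hsucc : ∀ j : ℕ, Fin.ofNat (k + 1) j + 1 = Fin.ofNat (k + 1) (j + 1) := by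
      intro j
      apply Fin.ext
      simp [Fin.val_add]
    have hc : ∀ j : ℕ, j ≤ k →
        Conn I.ends (F \ {e 0}) (v 1) (v (Fin.ofNat (k + 1) (j + 1))) := by
      intro j
      induction j with
      | zero =>
        intro _
        have : Fin.ofNat (k + 1) (0 + 1) = 1 := by rw [← hsucc]; simp
        rw [this]
        exact Conn.refl _
      | succ j ih =>
        intro hj
        refine (ih (by omega)).trans (Relation.ReflTransGen.single
          ⟨e (Fin.ofNat (k + 1) (j + 1)), ⟨(hl _).1, fun h0 => ?_⟩, ?_⟩)
        · have := congrArg Fin.val (he h0)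
          simp only [Fin.val_ofNat, Fin.val_zero] at this
          rw [Nat.mod_eq_of_lt (by omega)] at this
          omega
        · rw [← hsucc (j + 1)]
          exact (hl (Fin.ofNat (k + 1) (j + 1))).2
    have h1 := hc k le_rfl
    have h2 : Fin.ofNat (k + 1) (k + 1) = 0 := Fin.ext (by simp)
    rw [h2] at h1
    obtain ⟨h0, hl0⟩ := hl 0
    rw [zero_add] at hl0
    have := h (e 0) h0
    rcases hl0 with hl0 | hl0 <;> rw [hl0] at this
    · exact this h1.symm
    · exact this h1


theorem Input.isComponent_induce_iff (S : Set (Fin I.n)) :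
    IsComponent I.graph (I.graph.induce S) ↔ ∃ x, S = {y | Conn I.ends Set.univ x y} := by
  constructor
  · rintro ⟨x, -, hx⟩
    refine ⟨x, ?_⟩
    rw [← I.vertexSet_component, ← hx]
    rfl
  · rintro ⟨x, rfl⟩
    refine ⟨x, trivial, ?_⟩
    rw [← I.vertexSet_component]
    rfl

variable [AddCommGroup Γ]

/-- A set of vertices that consists of one vertex of each component whose labels are all zero. -/
def Input.IsRoots (R : Fin I.n → Prop) : Prop :=
  (∀ v, ∃ u, Conn I.ends Set.univ v u ∧ (I.label u ≠ 0 ∨ R u)) ∧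
    ∀ v, R v → ∀ u, Conn I.ends Set.univ v u → I.label u = 0 ∧ (R u → u = v)

open Classical in
/-- The labels, with an additional coordinate that marks the roots. -/
def Input.rootedLabel (R : Fin I.n → Prop) (v : Fin I.n) : Γ × ℤ :=
  (I.label v, if R v then 1 else 0)

theorem Input.classSum_rootedLabel_ne_zero_iff (R : Fin I.n → Prop) (F : Set (Fin I.m))
    (v : Fin I.n) : classSum I.ends (I.rootedLabel R) F v ≠ 0 ↔
      classSum I.ends I.label F v ≠ 0 ∨ ∃ u, Conn I.ends F v u ∧ R u := by
  classical
  have h1 : (classSum I.ends (I.rootedLabel R) F v).1 = classSum I.ends I.label F v := by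
    simp [classSum, Prod.fst_sum, rootedLabel]
  have h2 : (classSum I.ends (I.rootedLabel R) F v).2 = 0 ↔ ∀ u, Conn I.ends F v u → ¬ R u := by
    simp [classSum, Prod.snd_sum, rootedLabel, Finset.filter_eq_empty_iff]
  rw [Ne, Prod.ext_iff, h1, Prod.snd_zero, h2, Prod.fst_zero]
  push Not
  tauto

theorem finsum_component (F : Set (Fin I.m)) (x : Fin I.n) :
    ∑ᶠ v ∈ (component (I.graph.restrict F) x).vertexSet, I.label v =
      classSum I.ends I.label F x := by
  classical
  rw [I.vertexSet_component_restrict, classSum, ← finsum_mem_coe_finset]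
  simp

theorem Input.isFeasible_iff {R : Fin I.n → Prop} (hR : I.IsRoots R) (F : Finset (Fin I.m)) :
    I.IsFeasible F ↔ Feas I.ends (I.rootedLabel R) (F : Set (Fin I.m)) := by
  unfold IsFeasible Feas
  rw [I.isAcyclicSet_iff]
  refine and_congr_right fun _ => ?_
  simp only [I.classSum_rootedLabel_ne_zero_iff]
  constructor
  · intro h v
    by_contra! hc
    obtain ⟨h1, h2⟩ := h _ ⟨v, trivial, rfl⟩
    rw [finsum_component] at h1
    have hz := h1.resolve_left (not_not.2 hc.1)
    obtain ⟨x, hx⟩ := (I.isComponent_induce_iff _).1 (h2 hz)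
    rw [I.vertexSet_component_restrict] at hx hz
    obtain ⟨u, hu, hu'⟩ := hR.1 v
    have hvx : Conn I.ends Set.univ x v := by
      have : v ∈ {y | Conn I.ends (F : Set (Fin I.m)) v y} := Conn.refl v
      rwa [hx] at this
    have huv : u ∈ {y | Conn I.ends (F : Set (Fin I.m)) v y} := hx ▸ hvx.trans hu
    exact hc.2 u huv (hu'.resolve_left (not_not.2 (hz u huv)))
  · rintro h C ⟨x, -, rfl⟩
    rw [finsum_component, I.isComponent_induce_iff, I.vertexSet_component_restrict]
    have huniv : ∀ {u v}, Conn I.ends (F : Set (Fin I.m)) u v → Conn I.ends Set.univ u v :=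
      fun h => h.mono (Set.subset_univ _)
    refine ⟨(h x).imp_right ?_, fun hz => ⟨x, ?_⟩⟩
    · rintro ⟨u, hxu, hu⟩ v hv
      exact (hR.2 u hu v ((huniv hxu).symm.trans (huniv hv))).1
    · have hx : classSum I.ends I.label (F : Set (Fin I.m)) x = 0 :=
        Finset.sum_eq_zero fun v hv => hz v (by simpa using hv)
      obtain ⟨u, hxu, hu⟩ := (h x).resolve_left (not_not.2 hx)
      refine Set.Subset.antisymm (fun y hy => huniv hy) fun y hy => ?_
      have huy : Conn I.ends Set.univ u y := (huniv hxu).symm.trans hy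
      have hy0 : classSum I.ends I.label (F : Set (Fin I.m)) y = 0 :=
        Finset.sum_eq_zero fun v hv =>
          (hR.2 u hu v (huy.trans (huniv (by simpa using hv)))).1
      obtain ⟨u', hyu', hu'⟩ := (h y).resolve_left (not_not.2 hy0)
      have := (hR.2 u hu u' (huy.trans (huniv hyu'))).2 hu'
      exact hxu.trans (this ▸ hyu'.symm)

theorem Input.IsRoots.separable {R : Fin I.n → Prop} (hR : I.IsRoots R) :
    Separable I.ends (I.rootedLabel R) ∅ Set.univ := by
  refine ⟨acyc_empty, fun v => ?_⟩
  obtain ⟨u, hu, h⟩ := hR.1 v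
  refine ⟨u, hu, (I.classSum_rootedLabel_ne_zero_iff R _ _).2 (h.imp (fun h => ?_) fun h =>
    ⟨u, Conn.refl u, h⟩)⟩
  simpa [classSum, conn_empty, Finset.filter_eq] using h

end Translation

section Lengths

open Polynomial

theorem intLength_add_le {x y : ℤ} {a b : ℕ} (hx : intLength x ≤ a) (hy : intLength y ≤ b) :
    intLength (x + y) ≤ max a b + 1 := by
  unfold intLength at *
  have hx' : x.natAbs < 2 ^ (max a b - 1) := Nat.size_le.1 (by omega)
  have hy' : y.natAbs < 2 ^ (max a b - 1) := Nat.size_le.1 (by omega)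
  have : (x + y).natAbs.size ≤ max a b := by
    rw [Nat.size_le]
    obtain ⟨c, hc⟩ : ∃ c, max a b = c + 1 := ⟨max a b - 1, by omega⟩
    rw [hc, Nat.add_sub_cancel] at hx' hy'
    rw [hc, pow_succ]
    have := Int.natAbs_add_le x y
    omega
  omega

theorem intLength_neg (x : ℤ) : intLength (-x) = intLength x := by simp [intLength]

theorem intLength_mul_le (x y : ℤ) : intLength (x * y) ≤ intLength x + intLength y := by
  unfold intLength
  have : (x * y).natAbs.size ≤ x.natAbs.size + y.natAbs.size := by
    rw [Nat.size_le, Int.natAbs_mul, pow_add]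
    exact Nat.mul_lt_mul'' (Nat.lt_size_self _) (Nat.lt_size_self _)
  omega

/-- All integers in memory have length at most `l`. -/
def Memory.Small {Γ : Type*} (l : ℕ) (s : Memory Γ) : Prop :=
  ∀ a i, intLength (s.int a i) ≤ l

/-- Multiplication occurs only in array indices and in comparisons. -/
def Expr.MulFree : Expr → Prop
  | .const _ => True
  | .get _ _ => True
  | .add x y => x.MulFree ∧ y.MulFree
  | .sub x y => x.MulFree ∧ y.MulFree
  | .mul _ _ => False
  | .lt _ _ => True
  | .eq _ _ => True

/-- How much longer than the integers in memory the value of a `MulFree` expression can be. -/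
def Expr.growth : Expr → ℕ
  | .const z => intLength z
  | .get _ _ => 0
  | .add x y => x.growth + y.growth + 1
  | .sub x y => x.growth + y.growth + 1
  | .mul _ _ => 0
  | .lt _ _ => 2
  | .eq _ _ => 2

/-- A bound for the length of the value, when the integers in memory have length at most `L`. -/
def Expr.len (L : ℕ[X]) : Expr → ℕ[X]
  | .const z => (intLength z : ℕ[X])
  | .get _ _ => L
  | .add x y => x.len L + y.len L + 1
  | .sub x y => x.len L + y.len L + 1
  | .mul x y => x.len L + y.len L
  | .lt _ _ => 2
  | .eq _ _ => 2

/-- A bound for the cost, when the integers in memory have length at most `L`. -/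
def Expr.time (L : ℕ[X]) : Expr → ℕ[X]
  | .const z => (intLength z : ℕ[X])
  | .get _ i => i.time L + L
  | .add x y => x.time L + y.time L + x.len L + y.len L
  | .sub x y => x.time L + y.time L + x.len L + y.len L
  | .mul x y => x.time L + y.time L + x.len L * y.len L
  | .lt x y => x.time L + y.time L + x.len L + y.len L
  | .eq x y => x.time L + y.time L + x.len L + y.len L

variable {Γ : Type*} {s : Memory Γ}

theorem intLength_ite_le (p : Prop) [Decidable p] : intLength (if p then 1 else 0) ≤ 2 := by
  split_ifs <;> simp [intLength]

theorem Expr.intLength_val_le_growth {l : ℕ} (hs : s.Small l) (x : Expr) (hx : x.MulFree) :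
    intLength (x.val s) ≤ l + x.growth := by
  induction x with
  | const z => simp [Expr.val, growth]
  | get a i => exact hs _ _
  | add x y ihx ihy =>
    refine (intLength_add_le (ihx hx.1) (ihy hx.2)).trans ?_
    simp only [growth]; omega
  | sub x y ihx ihy =>
    simp only [Expr.val, sub_eq_add_neg]
    refine (intLength_add_le (ihx hx.1) ((intLength_neg _).trans_le (ihy hx.2))).trans ?_
    simp only [growth]; omega
  | mul => exact hx.elim
  | lt | eq => exact (intLength_ite_le _).trans (Nat.le_add_left _ _)

theorem Expr.intLength_val_le {L : ℕ[X]} {N : ℕ} (hs : s.Small (L.eval N)) (x : Expr) :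
    intLength (x.val s) ≤ (x.len L).eval N := by
  induction x with
  | const z => simp [Expr.val, len]
  | get a i => exact hs _ _
  | add x y ihx ihy =>
    refine (intLength_add_le ihx ihy).trans ?_
    simp only [len, eval_add, eval_one]; omega
  | sub x y ihx ihy =>
    simp only [Expr.val, sub_eq_add_neg]
    refine (intLength_add_le ihx ((intLength_neg _).trans_le ihy)).trans ?_
    simp only [len, eval_add, eval_one]; omega
  | mul x y ihx ihy =>
    refine (intLength_mul_le _ _).trans ?_
    simp only [len, eval_add]; omega
  | lt | eq => exact (intLength_ite_le _).trans (by simp [len])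

theorem Expr.cost_le {L : ℕ[X]} {N : ℕ} (hs : s.Small (L.eval N)) (x : Expr) :
    x.cost s ≤ (x.time L).eval N := by
  induction x with
  | const z => simp [cost, time]
  | get a i ih =>
    have := hs a (i.val s).toNat
    simp only [cost, time, eval_add]; omega
  | add x y ihx ihy | sub x y ihx ihy | lt x y ihx ihy | eq x y ihx ihy =>
    have := x.intLength_val_le hs
    have := y.intLength_val_le hs
    simp only [cost, time, eval_add]; omega
  | mul x y ihx ihy =>
    have := Nat.mul_le_mul (x.intLength_val_le hs) (y.intLength_val_le hs)
    simp only [cost, time, eval_add, eval_mul]; omega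

theorem Memory.Small.mono {l l' : ℕ} (hs : s.Small l) (h : l ≤ l') : s.Small l' :=
  fun a i => (hs a i).trans h

theorem Memory.Small.setInt {l : ℕ} (hs : s.Small l) {z : ℤ} (hz : intLength z ≤ l) (a i : ℕ) :
    (s.setInt a i z).Small l := by
  intro a' i'
  simp only [Memory.setInt]
  split_ifs
  · exact hz
  · exact hs _ _

end Lengths

/-! ### Programs with bounded loops -/

section Commands

open Polynomial

/-- Programs whose loops count up to an entry of integer array `0`. In `count a j p`, the counter
is entry `0` of array `a`, and `p` is run once for each value of the counter below entry `j` of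
array `0`. -/
inductive Cmd where
  | nop
  | set (a : ℕ) (i x : Expr)
  | groupAdd (a : ℕ) (i : Expr) (b : ℕ) (j : Expr) (c : ℕ) (k : Expr)
  | groupIsZero (a : ℕ) (i : Expr) (b : ℕ) (j : Expr)
  | seq (p r : Cmd)
  | branch (x : Expr) (p r : Cmd)
  | count (a j : ℕ) (p : Cmd)

namespace Cmd

/-- The value of a counter. -/
abbrev entry (a : ℕ) : Expr := .get a (.const 0)

/-- Increment the counter `a`. -/
def incr (a : ℕ) : Prog := .set a (.const 0) (.add (entry a) (.const 1))

/-- The counter `a` has not reached its bound. -/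
def cond (a j : ℕ) : Expr := .lt (entry a) (.get 0 (.const j))

def compile : Cmd → Prog
  | .nop => .nop
  | .set a i x => .set a i x
  | .groupAdd a i b j c k => .groupAdd a i b j c k
  | .groupIsZero a i b j => .groupIsZero a i b j
  | .seq p r => .seq p.compile r.compile
  | .branch x p r => .branch x p.compile r.compile
  | .count a j p => .seq (.set a (.const 0) (.const 0)) (.loop (cond a j) (.seq p.compile (incr a)))

/-- The integer arrays that are written. -/
def writes : Cmd → Finset ℕ
  | .nop => ∅
  | .set a _ _ => {a}
  | .groupAdd _ _ _ _ _ _ => ∅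
  | .groupIsZero a _ _ _ => {a}
  | .seq p r => p.writes ∪ r.writes
  | .branch _ p r => p.writes ∪ r.writes
  | .count a _ p => insert a p.writes

/-- The group arrays that are written. -/
def groupWrites : Cmd → Finset ℕ
  | .nop => ∅
  | .set _ _ _ => ∅
  | .groupAdd a _ _ _ _ _ => {a}
  | .groupIsZero _ _ _ _ => ∅
  | .seq p r => p.groupWrites ∪ r.groupWrites
  | .branch _ p r => p.groupWrites ∪ r.groupWrites
  | .count _ _ p => p.groupWrites

/-- Loops do not write to their counters or bounds, and products are not stored. -/
def WellFormed : Cmd → Prop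
  | .nop => True
  | .set _ _ x => x.MulFree
  | .groupAdd _ _ _ _ _ _ => True
  | .groupIsZero _ _ _ _ => True
  | .seq p r => p.WellFormed ∧ r.WellFormed
  | .branch _ p r => p.WellFormed ∧ r.WellFormed
  | .count a _ p => p.WellFormed ∧ a ∉ p.writes ∧ a ≠ 0 ∧ 0 ∉ p.writes

/-- A bound for the increase of the lengths of the integers in memory, when the bounds of loops
are at most the argument. -/
def growth : Cmd → ℕ[X]
  | .nop => 0
  | .set _ _ x => (x.growth : ℕ[X])
  | .groupAdd _ _ _ _ _ _ => 0
  | .groupIsZero _ _ _ _ => 2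
  | .seq p r => p.growth + r.growth
  | .branch _ p r => p.growth + r.growth
  | .count _ _ p => X * (p.growth + 3) + 1

/-- A bound for the running time, when group operations cost at most `b`, the integers in memory
have length at most `L` at the beginning, and the bounds of loops are at most the argument. -/
def time (b : ℕ[X]) : ℕ[X] → Cmd → ℕ[X]
  | _, .nop => 1
  | L, .set _ i x => i.time L + x.time L + 1
  | L, .groupAdd _ i _ j _ k => i.time L + j.time L + k.time L + b + 1
  | L, .groupIsZero _ i _ j => i.time L + j.time L + b + 1
  | L, .seq p r => time b L p + time b (L + p.growth) r + 1
  | L, .branch x p r => x.time L + time b L p + time b L r + 1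
  | L, .count a j p =>
    5 + (X + 1) * ((cond a j).time (L + (X * (p.growth + 3) + 1)) +
      (time b (L + (X * (p.growth + 3) + 1)) p +
        ((Expr.const 0).time (L + (X * (p.growth + 3) + 1)) +
          (Expr.add (entry a) (.const 1)).time (L + (X * (p.growth + 3) + 1)) + 1) + 1) + 1)

variable {Γ : Type*} [AddCommGroup Γ]

open Classical in
/-- The effect on the memory. -/
def run : Cmd → Memory Γ → Memory Γ
  | .nop, s => s
  | .set a i x, s => s.setInt a (i.val s).toNat (x.val s)
  | .groupAdd a i b j c k, s =>
    s.setGrp a (i.val s).toNat (s.grp b (j.val s).toNat + s.grp c (k.val s).toNat)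
  | .groupIsZero a i b j, s =>
    s.setInt a (i.val s).toNat (if s.grp b (j.val s).toNat = 0 then 1 else 0)
  | .seq p r, s => r.run (p.run s)
  | .branch x p r, s => if x.val s ≠ 0 then p.run s else r.run s
  | .count a j p, s =>
    Memory.setInt
      (Nat.rec s (fun k st => p.run (st.setInt a 0 k)) (s.int 0 j).toNat) a 0 (s.int 0 j).toNat

/-- The state before iteration `k` of a counting loop (before the counter is updated). -/
def iter (a : ℕ) (p : Cmd) (s : Memory Γ) (k : ℕ) : Memory Γ :=
  Nat.rec s (fun k st => p.run (st.setInt a 0 k)) k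

/-- Group operations are applied to elements of `K` only. -/
def Safe (K : Set Γ) : Cmd → Memory Γ → Prop
  | .nop, _ => True
  | .set _ _ _, _ => True
  | .groupAdd _ _ b j c k, s => s.grp b (j.val s).toNat ∈ K ∧ s.grp c (k.val s).toNat ∈ K
  | .groupIsZero _ _ b j, s => s.grp b (j.val s).toNat ∈ K
  | .seq p r, s => p.Safe K s ∧ r.Safe K (p.run s)
  | .branch x p r, s => (x.val s ≠ 0 → p.Safe K s) ∧ (x.val s = 0 → r.Safe K s)
  | .count a j p, s => ∀ k < (s.int 0 j).toNat, p.Safe K ((iter a p s k).setInt a 0 k)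

theorem run_count (a j : ℕ) (p : Cmd) (s : Memory Γ) :
    (count a j p).run s = (iter a p s (s.int 0 j).toNat).setInt a 0 (s.int 0 j).toNat := rfl

theorem iter_succ (a : ℕ) (p : Cmd) (s : Memory Γ) (k : ℕ) :
    iter a p s (k + 1) = p.run ((iter a p s k).setInt a 0 k) := rfl

theorem _root_.GammaGraphic.Memory.int_setInt_of_ne {Γ : Type*} (s : Memory Γ) {a b : ℕ}
    (h : b ≠ a) (i : ℕ) (z : ℤ) : (s.setInt a i z).int b = s.int b := by
  funext i'
  simp [Memory.setInt, h]

theorem int_run_of_notMem (c : Cmd) (s : Memory Γ) {a : ℕ} (ha : a ∉ c.writes) :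
    (c.run s).int a = s.int a := by
  induction c generalizing s with
  | nop | groupAdd => rfl
  | set | groupIsZero => exact s.int_setInt_of_ne (by simpa [writes] using ha) _ _
  | seq p r ihp ihr =>
    simp only [writes, Finset.mem_union, not_or] at ha
    exact (ihr _ ha.2).trans (ihp _ ha.1)
  | branch x p r ihp ihr =>
    simp only [writes, Finset.mem_union, not_or] at ha
    simp only [run]
    split_ifs
    · exact ihp _ ha.1
    · exact ihr _ ha.2
  | count b j p ih =>
    simp only [writes, Finset.mem_insert, not_or] at ha
    rw [run_count, Memory.int_setInt_of_ne _ ha.1]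
    induction (s.int 0 j).toNat with
    | zero => rfl
    | succ k ihk => rw [iter_succ, ih _ ha.2, Memory.int_setInt_of_ne _ ha.1, ihk]

theorem int_iter_of_notMem {a : ℕ} {p : Cmd} (s : Memory Γ) (k : ℕ) {b : ℕ} (hb : b ∉ p.writes)
    (hba : b ≠ a) : (iter a p s k).int b = s.int b := by
  induction k with
  | zero => rfl
  | succ k ihk => rw [iter_succ, int_run_of_notMem _ _ hb, Memory.int_setInt_of_ne _ hba, ihk]

theorem grp_run_of_notMem (c : Cmd) (s : Memory Γ) {a : ℕ} (ha : a ∉ c.groupWrites) :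
    (c.run s).grp a = s.grp a := by
  induction c generalizing s with
  | nop | set | groupIsZero => rfl
  | groupAdd =>
    funext i
    simp only [groupWrites, Finset.mem_singleton] at ha
    simp [run, Memory.setGrp, ha]
  | seq p r ihp ihr =>
    simp only [groupWrites, Finset.mem_union, not_or] at ha
    exact (ihr _ ha.2).trans (ihp _ ha.1)
  | branch x p r ihp ihr =>
    simp only [groupWrites, Finset.mem_union, not_or] at ha
    simp only [run]
    split_ifs
    · exact ihp _ ha.1
    · exact ihr _ ha.2
  | count b j p ih =>
    rw [run_count]
    change (iter b p s _).grp a = _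
    induction (s.int 0 j).toNat with
    | zero => rfl
    | succ k ihk => rw [iter_succ, ih _ ha]; exact ihk

theorem exec_compile {T : GroupCosts Γ} {K : Set Γ} {N : ℕ} {b : ℕ[X]}
    (hadd : ∀ g ∈ K, ∀ h ∈ K, T.addTime g h ≤ b.eval N) (hzero : ∀ g ∈ K, T.zeroTime g ≤ b.eval N)
    (c : Cmd) (hc : c.WellFormed) (hc0 : 0 ∉ c.writes) (L : ℕ[X]) (s : Memory Γ)
    (h0 : ∀ j, s.int 0 j ≤ N) (hs : s.Small (L.eval N)) (hsafe : c.Safe K s) :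
    (c.run s).Small ((L + c.growth).eval N) ∧
      ∃ t ≤ (c.time b L).eval N, Exec T c.compile s (c.run s) t := by
  classical
  induction c generalizing L s with
  | nop => exact ⟨Memory.Small.mono (s := s) hs (by simp), 1, by simp [time], Exec.nop s⟩
  | set a i x =>
    refine ⟨?_, _, ?_, Exec.set s a i x⟩
    · simp only [growth, eval_add, eval_natCast]
      exact (hs.mono (Nat.le_add_right _ _)).setInt (x.intLength_val_le_growth hs hc) _ _
    · have := i.cost_le hs
      have := x.cost_le hs
      simp only [time, eval_add, eval_one]; omega
  | groupAdd a i b' j c k =>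
    refine ⟨Memory.Small.mono (s := s) hs (by simp), _, ?_, Exec.groupAdd s a i b' j c k⟩
    have := i.cost_le hs
    have := j.cost_le hs
    have := k.cost_le hs
    have := hadd _ hsafe.1 _ hsafe.2
    simp only [time, eval_add, eval_one]; omega
  | groupIsZero a i b' j =>
    refine ⟨?_, _, ?_, Exec.groupIsZero s a i b' j⟩
    · simp only [growth, eval_add, eval_ofNat]
      exact (hs.mono (Nat.le_add_right _ _)).setInt
        ((intLength_ite_le _).trans (Nat.le_add_left _ _)) _ _
    · have := i.cost_le hs
      have := j.cost_le hs
      have := hzero _ hsafe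
      simp only [time, eval_add, eval_one]; omega
  | seq p r ihp ihr =>
    simp only [writes, Finset.mem_union, not_or] at hc0
    obtain ⟨h1, t1, ht1, e1⟩ := ihp hc.1 hc0.1 L s h0 hs hsafe.1
    obtain ⟨h2, t2, ht2, e2⟩ := ihr hc.2 hc0.2 (L + p.growth) (p.run s)
      (by rwa [int_run_of_notMem _ _ hc0.1]) h1 hsafe.2
    refine ⟨h2.mono (by simp [growth, add_assoc]), _, ?_, Exec.seq e1 e2⟩
    simp only [time, eval_add, eval_one] at *; omega
  | branch x p r ihp ihr =>
    simp only [writes, Finset.mem_union, not_or] at hc0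
    have := x.cost_le hs
    by_cases hx : x.val s = 0
    · obtain ⟨h2, t2, ht2, e2⟩ := ihr hc.2 hc0.2 L s h0 hs (hsafe.2 hx)
      have hrun : (branch x p r).run s = r.run s := by simp [run, hx]
      rw [hrun]
      refine ⟨h2.mono ?_, _, ?_, Exec.branch_false hx e2⟩
      · simp only [growth, eval_add]; omega
      · simp only [time, eval_add, eval_one]; omega
    · obtain ⟨h2, t2, ht2, e2⟩ := ihp hc.1 hc0.1 L s h0 hs (hsafe.1 hx)
      have hrun : (branch x p r).run s = p.run s := by simp [run, hx]
      rw [hrun]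
      refine ⟨h2.mono ?_, _, ?_, Exec.branch_true hx e2⟩
      · simp only [growth, eval_add]; omega
      · simp only [time, eval_add, eval_one]; omega
  | count a j p ih =>
    obtain ⟨hp, hap, ha0, hp0⟩ := hc
    set B := (s.int 0 j).toNat with hB
    have hBN : B ≤ N := by have := h0 j; omega
    have hB' : ∀ k, (iter a p s k).int 0 j = s.int 0 j := fun k => by
      rw [int_iter_of_notMem s k hp0 ha0.symm]
    have hlen : ∀ k : ℕ, k ≤ B → ∀ l, l = (L.eval N + 1) + k * (p.growth.eval N + 3) →
        ((iter a p s k).setInt a 0 k).Small l := by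
      intro k
      induction k with
      | zero =>
        rintro - l rfl
        exact (hs.mono (by omega)).setInt (by simp [intLength]) _ _
      | succ k ihk =>
        rintro hk l rfl
        have h1 := ihk (by omega) _ rfl
        obtain ⟨h2, -⟩ := ih hp hp0 (L + 1 + (k : ℕ[X]) * (p.growth + 3)) _
          (by rw [Memory.int_setInt_of_ne _ ha0.symm, int_iter_of_notMem s k hp0 ha0.symm]; exact h0)
          (h1.mono (by simp)) (hsafe k (by omega))
        rw [← iter_succ] at h2
        have hl : (L + 1 + (k : ℕ[X]) * (p.growth + 3) + p.growth).eval N + 3 ≤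
            L.eval N + 1 + (k + 1) * (p.growth.eval N + 3) := by
          simp only [eval_add, eval_mul, eval_one, eval_natCast, eval_ofNat]
          linarith
        refine (h2.mono (by omega)).setInt ?_ _ _
        have h3 := Expr.intLength_val_le_growth h2 (.add (entry a) (.const 1)) ⟨trivial, trivial⟩
        have hv : ((Expr.add (entry a) (.const 1)).val (iter a p s (k + 1)) : ℤ) = (k + 1 : ℕ) := by
          have : (iter a p s (k + 1)).int a 0 = k := by
            rw [iter_succ, int_run_of_notMem _ _ hap]
            simp [Memory.setInt]
          simp [Expr.val, this]
        rw [hv] at h3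
        have : (Expr.add (entry a) (.const 1)).growth = 3 := by
          simp [Expr.growth, intLength]
        omega
    set L' := L + (X * (p.growth + 3) + 1) with hL'
    have hL'N : L'.eval N = L.eval N + 1 + N * (p.growth.eval N + 3) := by
      simp only [hL', eval_add, eval_mul, eval_one, eval_X, eval_ofNat]
      ring
    have hsmall : ∀ k ≤ B, ((iter a p s k).setInt a 0 k).Small (L'.eval N) := by
      intro k hk
      refine (hlen k hk _ rfl).mono ?_
      rw [hL'N]
      have := Nat.mul_le_mul_right (p.growth.eval N + 3) (hk.trans hBN)
      omega
    set τ := (cond a j).time L' + (time b L' p + ((Expr.const 0).time L' +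
          (Expr.add (entry a) (.const 1)).time L' + 1) + 1) + 1 with hτ
    have hval : ∀ k, (cond a j).val ((iter a p s k).setInt a 0 k) =
        if (k : ℤ) < s.int 0 j then 1 else 0 := by
      intro k
      simp [cond, Expr.val, Memory.setInt, ha0.symm, hB']
    have hloop : ∀ d k, k + d = B → ∃ t ≤ (d + 1) * τ.eval N,
        Exec T (.loop (cond a j) (.seq p.compile (incr a))) ((iter a p s k).setInt a 0 k)
          ((iter a p s B).setInt a 0 B) t := by
      intro d
      induction d with
      | zero =>
        intro k hk
        rw [add_zero] at hk
        subst hk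
        refine ⟨_, ?_, Exec.loop_false ?_⟩
        · have := (cond a j).cost_le (hsmall _ le_rfl)
          simp only [hτ, eval_add, eval_one]; omega
        · rw [hval, if_neg]; omega
      | succ d ihd =>
        intro k hk
        obtain ⟨t', ht', e'⟩ := ihd (k + 1) (by omega)
        obtain ⟨h2, t, ht, e⟩ := ih hp hp0 L' _
          (by rw [Memory.int_setInt_of_ne _ ha0.symm, int_iter_of_notMem s k hp0 ha0.symm]; exact h0)
          (hsmall k (by omega)) (hsafe k (by omega))
        rw [← iter_succ] at e
        have h2' : (iter a p s (k + 1)).Small (L'.eval N) := by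
          intro a' i'
          by_cases h : a' = a ∧ i' = 0
          · obtain ⟨rfl, rfl⟩ := h
            have := hsmall k (by omega) a' 0
            rwa [iter_succ, int_run_of_notMem _ _ hap]
          · have := hsmall (k + 1) (by omega) a' i'
            simpa [Memory.setInt, h] using this
        have e2 := Exec.set (T := T) (iter a p s (k + 1)) a (.const 0)
          (.add (entry a) (.const 1))
        have hv : ((Expr.add (entry a) (.const 1)).val (iter a p s (k + 1)) : ℤ) = (k + 1 : ℕ) := by
          have : (iter a p s (k + 1)).int a 0 = k := by
            rw [iter_succ, int_run_of_notMem _ _ hap]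
            simp [Memory.setInt]
          simp [Expr.val, this]
        rw [hv] at e2
        refine ⟨_, ?_, Exec.loop_true ?_ (Exec.seq e e2) e'⟩
        · have h3 := (cond a j).cost_le (hsmall k (by omega))
          have h4 := (Expr.const 0).cost_le h2'
          have h5 := (Expr.add (entry a) (.const 1)).cost_le h2'
          rw [add_mul _ 1, one_mul]
          simp only [hτ, eval_add, eval_one] at ht' ⊢
          omega
        · rw [hval, if_pos (by omega)]; simp
    obtain ⟨t, ht, e⟩ := hloop B 0 (by omega)
    rw [run_count, ← hB]
    refine ⟨?_, _, ?_, Exec.seq (Exec.set s a (.const 0) (.const 0)) e⟩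
    · simp only [growth, ← hL']
      exact hsmall B le_rfl
    · have hmul : (B + 1) * τ.eval N ≤ (N + 1) * τ.eval N := Nat.mul_le_mul_right _ (by omega)
      have : (time b L (.count a j p)).eval N = 5 + (N + 1) * τ.eval N := by
        simp only [time, ← hL', ← hτ, eval_add, eval_mul, eval_one, eval_X, eval_ofNat]
      rw [this]
      simp only [Expr.cost, intLength, Int.natAbs_zero, Nat.size_zero]
      omega

/-- Started on memory `s`, the command is safe and leads to a memory satisfying `Q`. -/
def Ensures (K : Set Γ) (c : Cmd) (s : Memory Γ) (Q : Memory Γ → Prop) : Prop :=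
  c.Safe K s ∧ Q (c.run s)

variable {K : Set Γ} {s : Memory Γ} {Q Q' : Memory Γ → Prop}

theorem Ensures.mono {c : Cmd} (h : c.Ensures K s Q) (hQ : ∀ s', Q s' → Q' s') :
    c.Ensures K s Q' := ⟨h.1, hQ _ h.2⟩

/-- Arrays that are not written keep their contents. -/
theorem Ensures.frame {c : Cmd} (h : c.Ensures K s Q) :
    c.Ensures K s fun s' => Q s' ∧ (∀ a ∉ c.writes, s'.int a = s.int a) ∧
      ∀ a ∉ c.groupWrites, s'.grp a = s.grp a :=
  ⟨h.1, h.2, fun _ => int_run_of_notMem c s, fun _ => grp_run_of_notMem c s⟩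

theorem Ensures.nop (h : Q s) : nop.Ensures K s Q := ⟨trivial, h⟩

theorem Ensures.set {a : ℕ} {i x : Expr} (h : Q (s.setInt a (i.val s).toNat (x.val s))) :
    (set a i x).Ensures K s Q := ⟨trivial, h⟩

theorem Ensures.seq {c d : Cmd} (h : c.Ensures K s fun s' => d.Ensures K s' Q) :
    (seq c d).Ensures K s Q := ⟨⟨h.1, h.2.1⟩, h.2.2⟩

theorem Ensures.branch {x : Expr} {c d : Cmd} (h : x.val s ≠ 0 → c.Ensures K s Q)
    (h' : x.val s = 0 → d.Ensures K s Q) : (branch x c d).Ensures K s Q := by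
  refine ⟨⟨fun hx => (h hx).1, fun hx => (h' hx).1⟩, ?_⟩
  simp only [run]
  split_ifs with hx
  · exact (h hx).2
  · exact (h' (not_not.1 hx)).2

/-- Loops are verified by invariants. -/
theorem Ensures.count {a j : ℕ} {c : Cmd} {N : ℕ} (hN : s.int 0 j = N) (I : ℕ → Memory Γ → Prop)
    (h0 : I 0 s)
    (hstep : ∀ k < N, ∀ s' : Memory Γ, I k s' → (∀ b ∉ c.writes, b ≠ a → s'.int b = s.int b) →
      (∀ b ∉ c.groupWrites, s'.grp b = s.grp b) →
      c.Ensures K (s'.setInt a 0 k) (I (k + 1)))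
    (hQ : ∀ s', I N s' → Q (s'.setInt a 0 N)) : (count a j c).Ensures K s Q := by
  have hf : ∀ k, ∀ b ∉ c.writes, b ≠ a → (iter a c s k).int b = s.int b :=
    fun k b hb hba => int_iter_of_notMem s k hb hba
  have hg : ∀ k, ∀ b ∉ c.groupWrites, (iter a c s k).grp b = s.grp b := by
    intro k b hb
    induction k with
    | zero => rfl
    | succ k ih => rw [iter_succ, grp_run_of_notMem _ _ hb]; exact ih
  have hI : ∀ k ≤ N, I k (iter a c s k) := by
    intro k
    induction k with
    | zero => exact fun _ => h0
    | succ k ih => exact fun hk => (hstep k hk _ (ih (by omega)) (hf k) (hg k)).2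
  refine ⟨fun k hk => ?_, ?_⟩
  · rw [hN, Int.toNat_natCast] at hk
    exact (hstep k hk _ (hI k hk.le) (hf k) (hg k)).1
  · rw [run_count, hN, Int.toNat_natCast]
    exact hQ _ (hI N le_rfl)

end Cmd

end Commands

/-! ### The algorithm

Integer arrays: `5` and `6` indicate the edges already put in and left out, `7` and `8` name the
components of the edges put in and of the edges not left out, `9` and `10` tell whether these sets
are acyclic, `13` holds the absolute values of the numerators of the weights, `14` marks vertices
with nonzero component sum, `15` marks the roots, `16` and `17` hold results of searches and tests,
`18` and `19` the edge to be decided next. The other arrays are counters and temporary values.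
Group array `1` accumulates sums, and group array `2` is zero. -/

section Algorithm

open Cmd

/-- Rename the component `11` in array `C` to `12`. -/
def relabel (C : ℕ) : Cmd :=
  .count 22 0 (.branch (.eq (.get C (entry 22)) (entry 11)) (.set C (entry 22) (entry 12)) .nop)

/-- Process one edge in the computation of components. -/
def joinEdge (C : ℕ) (z : ℤ) : Cmd :=
  .branch (.eq (.get (C - 2) (entry 21)) (.const z))
    (.branch (.eq (.get C (.get 1 (entry 21))) (.get C (.get 2 (entry 21))))
      (.set (C + 2) (.const 0) (.const 0))
      (.seq (.set 11 (.const 0) (.get C (.get 1 (entry 21))))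
        (.seq (.set 12 (.const 0) (.get C (.get 2 (entry 21)))) (relabel C))))
    .nop

/-- Compute in array `C` the components of the set of edges with entry `z` in array `C - 2`, and
in array `C + 2` whether this set is acyclic. -/
def findComponents (C : ℕ) (z : ℤ) : Cmd :=
  .seq (.count 20 0 (.set C (entry 20) (entry 20)))
    (.seq (.set (C + 2) (.const 0) (.const 1)) (.count 21 1 (joinEdge C z)))

/-- Add up the labels of the component of vertex `23` in array `7`, and look for roots. -/
def sumComponent : Cmd :=
  .seq (.groupAdd 1 (.const 0) 2 (.const 0) 2 (.const 0))
    (.seq (.set 16 (.const 0) (.const 0))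
      (.count 24 0 (.branch (.eq (.get 7 (entry 24)) (.get 7 (entry 23)))
        (.seq (.groupAdd 1 (.const 0) 1 (.const 0) 0 (entry 24))
          (.branch (.get 15 (entry 24)) (.set 16 (.const 0) (.const 1)) .nop))
        .nop)))

/-- Mark the vertices whose component in array `7` has nonzero sum or contains a root. -/
def markNonzero : Cmd :=
  .count 23 0 (.seq sumComponent (.seq (.groupIsZero 11 (.const 0) 1 (.const 0))
    (.branch (entry 11) (.set 14 (entry 23) (entry 16)) (.set 14 (entry 23) (.const 1)))))

/-- Look for a marked vertex in the component of vertex `25` in array `8`. -/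
def searchMarked : Cmd :=
  .seq (.set 16 (.const 0) (.const 0))
    (.count 26 0 (.branch (.eq (.get 8 (entry 26)) (.get 8 (entry 25)))
      (.branch (.get 14 (entry 26)) (.set 16 (.const 0) (.const 1)) .nop) .nop))

/-- Decide whether some feasible set contains all edges put in and no edge left out. -/
def testSeparable : Cmd :=
  .seq (findComponents 7 1) (.seq (findComponents 8 0) (.seq markNonzero
    (.seq (.set 17 (.const 0) (entry 9))
      (.count 25 0 (.seq searchMarked
        (.branch (entry 16) .nop (.set 17 (.const 0) (.const 0))))))))

/-- Choose the roots. -/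
def findRoots : Cmd :=
  .seq (findComponents 8 0)
    (.seq (.count 23 0 (.seq (.groupIsZero 11 (.const 0) 0 (entry 23))
        (.set 14 (entry 23) (.sub (.const 1) (entry 11)))))
      (.count 25 0 (.seq searchMarked (.branch (entry 16) .nop
        (.seq (.set 15 (entry 25) (.const 1)) (.set 14 (entry 25) (.const 1)))))))

/-- Compute the absolute values of the numerators of the weights. -/
def absWeights : Cmd :=
  .count 20 1 (.branch (.lt (.get 3 (entry 20)) (.const 0))
    (.set 13 (entry 20) (.sub (.const 0) (.get 3 (entry 20))))
    (.set 13 (entry 20) (.get 3 (entry 20))))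

/-- Find an undecided edge whose weight has maximum absolute value. -/
def selectEdge : Cmd :=
  .seq (.set 18 (.const 0) (.const 0))
    (.count 20 1 (.branch (.eq (.get 5 (entry 20)) (.const 0))
      (.branch (.eq (.get 6 (entry 20)) (.const 0))
        (.branch (entry 18)
          (.branch (.lt (.mul (.get 13 (entry 19)) (.get 4 (entry 20)))
              (.mul (.get 13 (entry 20)) (.get 4 (entry 19))))
            (.set 19 (.const 0) (entry 20)) .nop)
          (.seq (.set 18 (.const 0) (.const 1)) (.set 19 (.const 0) (entry 20))))
        .nop) .nop))

/-- Record edge `19` in array `a`; if this fails the test, record it in array `b` instead. -/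
def tryEdge (a b : ℕ) : Cmd :=
  .seq (.set a (entry 19) (.const 1)) (.seq testSeparable
    (.branch (entry 17) .nop
      (.seq (.set a (entry 19) (.const 0)) (.set b (entry 19) (.const 1)))))

/-- Decide the selected edge. -/
def decideEdge : Cmd :=
  .branch (entry 18)
    (.branch (.lt (.get 3 (entry 19)) (.const 0)) (tryEdge 6 5) (tryEdge 5 6)) .nop

/-- The greedy algorithm. -/
def greedy : Cmd :=
  .seq findRoots (.seq absWeights (.count 27 1 (.seq selectEdge decideEdge)))

section Syntactic

variable {a C : ℕ} {z : ℤ}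

theorem mem_writes_relabel : a ∈ (relabel C).writes ↔ a = 22 ∨ a = C := by
  simp [relabel, writes]

theorem mem_writes_joinEdge :
    a ∈ (joinEdge C z).writes ↔ a = C + 2 ∨ a = 11 ∨ a = 12 ∨ a = 22 ∨ a = C := by
  simp [joinEdge, writes, mem_writes_relabel]; tauto

theorem mem_writes_findComponents : a ∈ (findComponents C z).writes ↔
    a = 20 ∨ a = C ∨ a = C + 2 ∨ a = 21 ∨ a = 11 ∨ a = 12 ∨ a = 22 := by
  simp only [findComponents, writes, Finset.mem_union, Finset.mem_insert, Finset.mem_singleton,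
    mem_writes_joinEdge]
  tauto

theorem mem_writes_sumComponent : a ∈ sumComponent.writes ↔ a = 16 ∨ a = 24 := by
  simp [sumComponent, writes]; tauto

theorem mem_writes_markNonzero :
    a ∈ markNonzero.writes ↔ a = 23 ∨ a = 16 ∨ a = 24 ∨ a = 11 ∨ a = 14 := by
  simp [markNonzero, writes, mem_writes_sumComponent]; tauto

theorem mem_writes_searchMarked : a ∈ searchMarked.writes ↔ a = 16 ∨ a = 26 := by
  simp [searchMarked, writes]; tauto

theorem mem_writes_testSeparable : a ∈ testSeparable.writes ↔
    a = 7 ∨ a = 8 ∨ a = 9 ∨ a = 10 ∨ a = 11 ∨ a = 12 ∨ a = 14 ∨ a = 16 ∨ a = 17 ∨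
      (20 ≤ a ∧ a ≤ 26) := by
  simp only [testSeparable, writes, Finset.mem_union, Finset.mem_insert, Finset.mem_singleton,
    mem_writes_findComponents, mem_writes_markNonzero, mem_writes_searchMarked,
    Finset.notMem_empty, false_or]
  omega

theorem mem_writes_findRoots : a ∈ findRoots.writes ↔
    a = 8 ∨ a = 10 ∨ a = 11 ∨ a = 12 ∨ a = 14 ∨ a = 15 ∨ a = 16 ∨ a = 20 ∨ a = 21 ∨ a = 22 ∨
      a = 23 ∨ a = 25 ∨ a = 26 := by
  simp only [findRoots, writes, Finset.mem_union, Finset.mem_insert, Finset.mem_singleton,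
    mem_writes_findComponents, mem_writes_searchMarked, Finset.notMem_empty, false_or]
  omega

theorem mem_writes_absWeights : a ∈ absWeights.writes ↔ a = 20 ∨ a = 13 := by
  simp [absWeights, writes]

theorem mem_writes_selectEdge : a ∈ selectEdge.writes ↔ a = 18 ∨ a = 20 ∨ a = 19 := by
  simp [selectEdge, writes]; tauto

theorem mem_writes_decideEdge :
    a ∈ decideEdge.writes ↔ a = 5 ∨ a = 6 ∨ a ∈ testSeparable.writes := by
  simp only [decideEdge, tryEdge, writes, Finset.mem_union, Finset.mem_singleton,
    Finset.notMem_empty]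
  tauto

theorem groupWrites_findComponents : (findComponents C z).groupWrites = ∅ := by
  simp [findComponents, groupWrites, joinEdge, relabel]

theorem groupWrites_testSeparable : testSeparable.groupWrites = {1} := by
  simp [testSeparable, groupWrites, groupWrites_findComponents, markNonzero, searchMarked,
    sumComponent]

theorem wellFormed_findComponents (hC : C = 7 ∨ C = 8) : (findComponents C z).WellFormed := by
  simp only [findComponents, WellFormed, joinEdge, Expr.MulFree, relabel,
    writes, Finset.mem_union, Finset.mem_singleton, Finset.mem_insert, Finset.notMem_empty,
    or_false, true_and, and_true]
  omega

theorem wellFormed_searchMarked : searchMarked.WellFormed := by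
  simp [searchMarked, WellFormed, writes, Expr.MulFree]

theorem wellFormed_testSeparable : testSeparable.WellFormed := by
  simp [testSeparable, WellFormed, wellFormed_findComponents, wellFormed_searchMarked, writes,
    mem_writes_searchMarked, markNonzero, sumComponent, Expr.MulFree]

theorem wellFormed_decideEdge : decideEdge.WellFormed := by
  simp [decideEdge, tryEdge, WellFormed, wellFormed_testSeparable, Expr.MulFree]

theorem greedy_wellFormed : greedy.WellFormed := by
  simp [greedy, WellFormed, wellFormed_decideEdge, findRoots, wellFormed_findComponents,
    wellFormed_searchMarked, writes, mem_writes_searchMarked, absWeights, selectEdge,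
    mem_writes_decideEdge, mem_writes_testSeparable, Expr.MulFree]

theorem zero_notMem_writes_greedy : 0 ∉ greedy.writes := by
  simp [greedy, writes, mem_writes_findRoots, mem_writes_absWeights, mem_writes_selectEdge,
    mem_writes_decideEdge, mem_writes_testSeparable]

end Syntactic

variable {Γ : Type*} [AddCommGroup Γ] (I : Input Γ)

/-- The input is in the memory. -/
structure Loaded (s : Memory Γ) : Prop where
  n : s.int 0 0 = I.n
  m : s.int 0 1 = I.m
  left : ∀ e : Fin I.m, s.int 1 e = ((I.ends e).1 : ℕ)
  right : ∀ e : Fin I.m, s.int 2 e = ((I.ends e).2 : ℕ)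
  num : ∀ e : Fin I.m, s.int 3 e = (I.weight e).num
  den : ∀ e : Fin I.m, s.int 4 e = (I.weight e).den
  label : ∀ v : Fin I.n, s.grp 0 v = I.label v
  zero : s.grp 2 0 = 0

/-- The sums of labels over sets of vertices. -/
def Input.sums : Set Γ := {g | ∃ A : Finset (Fin I.n), g = ∑ v ∈ A, I.label v}

variable {I} {s s' : Memory Γ}

theorem Loaded.of_eq (h : Loaded I s) (hi : ∀ a < 5, s'.int a = s.int a)
    (h0 : s'.grp 0 = s.grp 0) (h2 : s'.grp 2 = s.grp 2) : Loaded I s' := by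
  constructor
  · rw [hi 0 (by omega)]; exact h.n
  · rw [hi 0 (by omega)]; exact h.m
  · rw [hi 1 (by omega)]; exact h.left
  · rw [hi 2 (by omega)]; exact h.right
  · rw [hi 3 (by omega)]; exact h.num
  · rw [hi 4 (by omega)]; exact h.den
  · rw [h0]; exact h.label
  · rw [h2]; exact h.zero

theorem Loaded.setInt (h : Loaded I s) {a : ℕ} (ha : 5 ≤ a) (i : ℕ) (z : ℤ) :
    Loaded I (s.setInt a i z) :=
  h.of_eq (fun b hb => Memory.int_setInt_of_ne _ (by omega) _ _) rfl rfl

theorem Input.memory_loaded : Loaded I I.memory := by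
  constructor <;> simp [Input.memory, toArray]

theorem ensures_relabel {C : ℕ} (hC : C = 7 ∨ C = 8) (h : Loaded I s) :
    (relabel C).Ensures I.sums s fun s' => ∀ v : Fin I.n, s'.int C v =
      if s.int C v = s.int 11 0 then s.int 12 0 else s.int C v := by
  refine Ensures.count h.n (fun k s' => ∀ v : Fin I.n, s'.int C v =
      if (v : ℕ) < k ∧ s.int C v = s.int 11 0 then s.int 12 0 else s.int C v) (by simp) ?_ ?_
  · intro k hk s' hI hf _
    have h11 : s'.int 11 = s.int 11 := hf 11 (by simp [writes]; omega) (by omega)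
    have h12 : s'.int 12 = s.int 12 := hf 12 (by simp [writes]; omega) (by omega)
    have hIk := hI ⟨k, hk⟩
    simp only [lt_irrefl, false_and, if_false] at hIk
    refine Ensures.branch (fun hx => Ensures.set fun v => ?_) fun hx => Ensures.nop fun v => ?_
    · have hIv := hI v
      rcases hC with rfl | rfl <;> simp [Expr.val, Memory.setInt, h11, h12, hIk] at hx ⊢ <;>
        by_cases hv : (v : ℕ) = k <;> grind
    · have hIv := hI v
      rcases hC with rfl | rfl <;> simp [Expr.val, Memory.setInt, h11, hIk] at hx ⊢ <;>
        by_cases hv : (v : ℕ) = k <;> grind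
  · intro s' hI v
    have := hI v
    rw [Memory.int_setInt_of_ne _ (by omega), this]
    simp [v.2]

/-- Array `C` names the components of `F`. -/
def Names (I : Input Γ) (C : ℕ) (F : Set (Fin I.m)) (s : Memory Γ) : Prop :=
  ∀ u v : Fin I.n, s.int C u = s.int C v ↔ Conn I.ends F u v

theorem Names.of_eq {Γ : Type*} {I : Input Γ} {s s' : Memory Γ} {C : ℕ} {F : Set (Fin I.m)}
    (h : Names I C F s)
    (he : s'.int C = s.int C) : Names I C F s' := by
  unfold Names
  rw [he]
  exact h

theorem ensures_joinEdge {C : ℕ} {z : ℤ} (hC : C = 7 ∨ C = 8) (h : Loaded I s) (e : Fin I.m)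
    (he : s.int 21 0 = (e : ℕ)) {F : Set (Fin I.m)} (heF : e ∉ F) (hN : Names I C F s)
    (hac : s.int (C + 2) 0 ≠ 0 ↔ Acyc I.ends F) {F' : Set (Fin I.m)}
    (hF' : F' = if s.int (C - 2) e = z then insert e F else F) :
    (joinEdge C z).Ensures I.sums s fun s' => Names I C F' s' ∧
      (s'.int (C + 2) 0 ≠ 0 ↔ Acyc I.ends F') := by
  have hl := h.left e
  have hr := h.right e
  have hcon := hN (I.ends e).1 (I.ends e).2
  refine Ensures.branch (fun hx => Ensures.branch (fun hy => Ensures.set ?_) fun hy =>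
    Ensures.seq (Ensures.set (Ensures.seq (Ensures.set ?_)))) fun hx => Ensures.nop ?_
  · have hsel : s.int (C - 2) e = z := by simpa [Expr.val, he] using hx
    have hc : Conn I.ends F (I.ends e).1 (I.ends e).2 := by
      rw [← hcon]; simpa [Expr.val, he, hl, hr] using hy
    rw [hF', if_pos hsel]
    constructor
    · intro u v
      have := hN u v
      rw [Memory.int_setInt_of_ne _ (by omega), this, conn_insert]
      refine ⟨Or.inl, ?_⟩
      rintro (h | ⟨h1, h2⟩ | ⟨h1, h2⟩)
      · exact h
      · exact (h1.trans hc).trans h2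
      · exact (h1.trans hc.symm).trans h2
    · simp [Expr.val, Memory.setInt, acyc_insert heF, hc]
  · have hsel : s.int (C - 2) e = z := by simpa [Expr.val, he] using hx
    have hc : ¬ Conn I.ends F (I.ends e).1 (I.ends e).2 := by
      rw [← hcon]; simpa [Expr.val, he, hl, hr] using hy
    rw [hF', if_pos hsel]
    refine (Ensures.frame (ensures_relabel hC ((h.setInt (by omega) _ _).setInt (by omega) _ _))).mono
      fun s' ⟨hs', hf, _⟩ => ⟨fun u v => ?_, ?_⟩
    · rw [hs' u, hs' v, conn_insert]
      have h1 := hN u (I.ends e).1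
      have h2 := hN u (I.ends e).2
      have h3 := hN (I.ends e).1 v
      have h4 := hN (I.ends e).2 v
      have h5 := hN u v
      rcases hC with rfl | rfl <;> simp [Expr.val, Memory.setInt, he, hl, hr] <;> grind
    · rw [hf (C + 2) (by rw [mem_writes_relabel]; omega), acyc_insert heF, ← hac]
      rcases hC with rfl | rfl <;> simp [Expr.val, Memory.setInt, hc]
  · have hsel : s.int (C - 2) e ≠ z := by simpa [Expr.val, he] using hx
    rw [hF', if_neg hsel]
    exact ⟨hN, hac⟩

theorem ensures_findComponents {C : ℕ} {z : ℤ} (hC : C = 7 ∨ C = 8) (h : Loaded I s) :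
    (findComponents C z).Ensures I.sums s fun s' =>
      Names I C {e | s.int (C - 2) e = z} s' ∧
        (s'.int (C + 2) 0 ≠ 0 ↔ Acyc I.ends {e | s.int (C - 2) e = z}) := by
  refine Ensures.seq (Ensures.frame (Ensures.count h.n
    (fun k s' => ∀ v : Fin I.n, (v : ℕ) < k → s'.int C v = (v : ℕ)) (by simp) ?_
      (Q := fun s' => ∀ v : Fin I.n, s'.int C v = (v : ℕ)) ?_) |>.mono
        fun s₁ ⟨h₁, hf, hg⟩ => ?_)
  · intro k hk s' hI _ _
    refine Ensures.set fun v hv => ?_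
    have hIv := hI v
    rcases hC with rfl | rfl <;> simp [Expr.val, Memory.setInt] <;> grind
  · intro s' hI v
    rw [Memory.int_setInt_of_ne _ (by omega), hI v v.2]
  have hl₁ : Loaded I s₁ := h.of_eq
    (fun a ha => hf a (by simp only [writes, Finset.mem_insert, Finset.mem_singleton]; omega))
    (hg 0 (by simp [groupWrites])) (hg 2 (by simp [groupWrites]))
  have hsel : s₁.int (C - 2) = s.int (C - 2) :=
    hf _ (by simp only [writes, Finset.mem_insert, Finset.mem_singleton]; omega)
  refine Ensures.seq (Ensures.set ?_)
  refine Ensures.count (hl₁.setInt (by omega) _ _).m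
    (fun k s' => Names I C {e | (e : ℕ) < k ∧ s.int (C - 2) e = z} s' ∧
        (s'.int (C + 2) 0 ≠ 0 ↔ Acyc I.ends {e | (e : ℕ) < k ∧ s.int (C - 2) e = z})) ?_ ?_ ?_
  · have : {e : Fin I.m | (e : ℕ) < 0 ∧ s.int (C - 2) e = z} = ∅ := by ext; simp
    rw [this]
    refine ⟨fun u v => ?_, ?_⟩
    · rw [Memory.int_setInt_of_ne _ (by omega), h₁, h₁, conn_empty, Fin.ext_iff, Nat.cast_inj]
    · simp [Memory.setInt, Expr.val, acyc_empty]
  · intro k hk s' ⟨hN, hac⟩ hf' hg'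
    have hl' : Loaded I s' := hl₁.of_eq
      (fun a ha => (hf' a (by rw [mem_writes_joinEdge]; omega) (by omega)).trans
        (by rw [Memory.int_setInt_of_ne _ (by omega)]))
      (hg' 0 (by simp [groupWrites, joinEdge, relabel]))
      (hg' 2 (by simp [groupWrites, joinEdge, relabel]))
    have hsel' : s'.int (C - 2) = s.int (C - 2) := by
      rw [hf' (C - 2) (by rw [mem_writes_joinEdge]; omega) (by omega),
        Memory.int_setInt_of_ne _ (by omega), hsel]
    refine ensures_joinEdge hC (hl'.setInt (by omega) _ _) ⟨k, hk⟩ (by simp [Memory.setInt])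
      (F := {e | (e : ℕ) < k ∧ s.int (C - 2) e = z}) (by simp) ?_ ?_ ?_
    · intro u v
      rw [Memory.int_setInt_of_ne _ (by omega)]
      exact hN u v
    · rw [Memory.int_setInt_of_ne _ (by omega)]
      exact hac
    · rw [Memory.int_setInt_of_ne _ (by omega), hsel']
      ext e
      split_ifs with hz
      · simp only [Set.mem_insert_iff, Fin.ext_iff, Set.mem_ofPred_eq]
        constructor
        · rintro ⟨h1, h2⟩
          by_cases hek : (e : ℕ) = k
          · exact Or.inl hek
          · exact Or.inr ⟨by omega, h2⟩
        · rintro (h1 | h1)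
          · exact ⟨by omega, by rw [h1]; exact hz⟩
          · exact ⟨by omega, h1.2⟩
      · simp only [Set.mem_ofPred_eq]
        refine ⟨fun ⟨h1, h2⟩ => ⟨?_, h2⟩, fun ⟨h1, h2⟩ => ⟨by omega, h2⟩⟩
        rcases Nat.lt_succ_iff_lt_or_eq.1 h1 with h1 | h1
        · exact h1
        · rw [h1] at h2; exact (hz h2).elim
  · intro s' ⟨hN, hac⟩
    have : {e : Fin I.m | (e : ℕ) < I.m ∧ s.int (C - 2) e = z} =
        {e : Fin I.m | s.int (C - 2) e = z} := by ext; simp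
    rw [this] at hN hac
    refine ⟨fun u v => ?_, ?_⟩
    · rw [Memory.int_setInt_of_ne _ (by omega)]
      exact hN u v
    · rw [Memory.int_setInt_of_ne _ (by omega)]
      exact hac

end Algorithm

section Verification

open Cmd

variable {Γ : Type*} [AddCommGroup Γ] {K : Set Γ} {I : Input Γ} {s : Memory Γ}

theorem Cmd.Ensures.groupAdd {Q : Memory Γ → Prop} {a : ℕ} {i : Expr} {b : ℕ} {j : Expr} {c : ℕ}
    {k : Expr} (hb : s.grp b (j.val s).toNat ∈ K) (hc : s.grp c (k.val s).toNat ∈ K)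
    (h : Q (s.setGrp a (i.val s).toNat (s.grp b (j.val s).toNat + s.grp c (k.val s).toNat))) :
    (groupAdd a i b j c k).Ensures K s Q := ⟨⟨hb, hc⟩, h⟩

open Classical in
theorem Cmd.Ensures.groupIsZero {Q : Memory Γ → Prop} {a : ℕ} {i : Expr} {b : ℕ} {j : Expr}
    (hb : s.grp b (j.val s).toNat ∈ K)
    (h : Q (s.setInt a (i.val s).toNat (if s.grp b (j.val s).toNat = 0 then 1 else 0))) :
    (groupIsZero a i b j).Ensures K s Q := ⟨hb, h⟩

theorem Input.zero_mem_sums : (0 : Γ) ∈ I.sums := ⟨∅, by simp⟩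

theorem Input.label_mem_sums (v : Fin I.n) : I.label v ∈ I.sums := ⟨{v}, by simp⟩

open Classical in
theorem ensures_sumComponent (h : Loaded I s) {X : Set (Fin I.m)} (hN : Names I 7 X s)
    (v : Fin I.n) (hv : s.int 23 0 = (v : ℕ)) :
    sumComponent.Ensures I.sums s fun s' => s'.grp 1 0 = classSum I.ends I.label X v ∧
      (s'.int 16 0 ≠ 0 ↔ ∃ u : Fin I.n, Conn I.ends X v u ∧ s.int 15 u ≠ 0) := by
  refine Ensures.seq (Ensures.groupAdd ?_ ?_ (Ensures.seq (Ensures.set ?_)))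
  · simpa [Expr.val, h.zero] using I.zero_mem_sums
  · simpa [Expr.val, h.zero] using I.zero_mem_sums
  refine Ensures.count (N := I.n) (by simpa [Memory.setInt, Memory.setGrp] using h.n)
    (fun k s' => s'.grp 1 0 =
        ∑ u ∈ Finset.univ.filter fun u : Fin I.n => (u : ℕ) < k ∧ Conn I.ends X v u,
      I.label u ∧
      (s'.int 16 0 ≠ 0 ↔ ∃ u : Fin I.n, (u : ℕ) < k ∧ Conn I.ends X v u ∧ s.int 15 u ≠ 0))
      ?_ ?_ ?_
  · simp [Memory.setInt, Memory.setGrp, Expr.val, h.zero]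
  · intro k hk s' ⟨h1, h2⟩ hf hg
    have h7 : s'.int 7 = s.int 7 := (hf 7 (by simp [writes]) (by simp)).trans
      (by simp [Memory.setInt, Memory.setGrp])
    have h15 : s'.int 15 = s.int 15 := (hf 15 (by simp [writes]) (by simp)).trans
      (by simp [Memory.setInt, Memory.setGrp])
    have h23 : s'.int 23 = s.int 23 := (hf 23 (by simp [writes]) (by simp)).trans
      (by simp [Memory.setInt, Memory.setGrp])
    have h0 : s'.grp 0 = s.grp 0 := (hg 0 (by simp [groupWrites])).trans
      (by funext i; simp [Memory.setInt, Memory.setGrp])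
    have hlab := h.label ⟨k, hk⟩
    have hcon := hN ⟨k, hk⟩ v
    simp only at hlab hcon
    have hcomm : Conn I.ends X ⟨k, hk⟩ v ↔ Conn I.ends X v ⟨k, hk⟩ := ⟨Conn.symm, Conn.symm⟩
    refine Ensures.branch (fun hx => ?_) fun hx => Ensures.nop ?_
    · have hc : Conn I.ends X v ⟨k, hk⟩ := by
        rw [← hcomm, ← hcon]
        simpa [Expr.val, Memory.setInt, h7, h23, hv] using hx
      have hsum : ∑ u ∈ Finset.univ.filter fun u : Fin I.n =>
          (u : ℕ) < k + 1 ∧ Conn I.ends X v u, I.label u =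
          s'.grp 1 0 + s'.grp 0 k := by
        rw [h1, h0, hlab, add_comm _ (I.label _), ← Finset.sum_insert (by simp)]
        refine Finset.sum_congr ?_ fun _ _ => rfl
        ext u
        simp only [Finset.mem_filter, Finset.mem_univ, true_and, Finset.mem_insert, Fin.ext_iff]
        constructor
        · rintro ⟨h3, h4⟩
          by_cases huk : (u : ℕ) = k
          · exact Or.inl huk
          · exact Or.inr ⟨by omega, h4⟩
        · rintro (h3 | h3)
          · exact ⟨by omega, by rwa [show u = ⟨k, hk⟩ from Fin.ext h3]⟩
          · exact ⟨by omega, h3.2⟩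
      refine Ensures.seq (Ensures.groupAdd ?_ ?_
        (Ensures.branch (fun hy => Ensures.set ⟨?_, ?_⟩) fun hy => Ensures.nop ⟨?_, ?_⟩))
      · simpa [Expr.val, Memory.setInt, h1] using ⟨_, rfl⟩
      · simpa [Expr.val, Memory.setInt, h0, hlab] using I.label_mem_sums ⟨k, hk⟩
      · rw [hsum]
        simp [Expr.val, Memory.setInt, Memory.setGrp]
      · have hy' : s.int 15 k ≠ 0 := by
          simpa [Expr.val, Memory.setInt, Memory.setGrp, h15] using hy
        simp only [Expr.val, Memory.setInt, Memory.setGrp]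
        simp only [Int.toNat_zero, and_self, if_true, ne_eq, one_ne_zero, not_false_eq_true,
          true_iff]
        exact ⟨⟨k, hk⟩, by simp, hc, hy'⟩
      · rw [hsum]
        simp [Expr.val, Memory.setInt, Memory.setGrp]
      · have hy' : s.int 15 k = 0 := by
          simpa [Expr.val, Memory.setInt, Memory.setGrp, h15] using hy
        have : (((s'.setInt 24 0 k).setGrp 1 ((Expr.const 0).val (s'.setInt 24 0 k)).toNat
          ((s'.setInt 24 0 k).grp 1 ((Expr.const 0).val (s'.setInt 24 0 k)).toNat +
            (s'.setInt 24 0 k).grp 0 ((entry 24).val (s'.setInt 24 0 k)).toNat)).int 16 0) =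
            s'.int 16 0 := by simp [Memory.setInt, Memory.setGrp]
        rw [this, h2]
        refine exists_congr fun u => and_congr_left fun h3 => ?_
        have : (u : ℕ) ≠ k := by rintro huk; rw [huk] at h3; exact h3.2 hy'
        omega
    · have hc : ¬ Conn I.ends X v ⟨k, hk⟩ := by
        rw [← hcomm, ← hcon]
        simpa [Expr.val, Memory.setInt, h7, h23, hv] using hx
      have hiff : ∀ u : Fin I.n, Conn I.ends X v u → ((u : ℕ) < k + 1 ↔ (u : ℕ) < k) := by
        intro u hu
        have : (u : ℕ) ≠ k := fun huk => hc (by rwa [show u = ⟨k, hk⟩ from Fin.ext huk] at hu)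
        omega
      constructor
      · refine h1.trans (Finset.sum_congr ?_ fun _ _ => rfl)
        ext u
        simp only [Finset.mem_filter, Finset.mem_univ, true_and]
        exact and_congr_left fun h3 => (hiff u h3).symm
      · have : (s'.setInt 24 0 k).int 16 0 = s'.int 16 0 := by simp [Memory.setInt]
        rw [this, h2]
        exact exists_congr fun u => and_congr_left fun h3 => (hiff u h3.1).symm
  · rintro s' ⟨h1, h2⟩
    constructor
    · refine h1.trans (Finset.sum_congr ?_ fun _ _ => rfl)
      ext u; simp
    · simpa [Memory.setInt] using h2

theorem ensures_markNonzero (h : Loaded I s) {X : Set (Fin I.m)} (hN : Names I 7 X s) :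
    markNonzero.Ensures I.sums s fun s' => ∀ v : Fin I.n, s'.int 14 v ≠ 0 ↔
      classSum I.ends (I.rootedLabel fun u => s.int 15 u ≠ 0) X v ≠ 0 := by
  refine Ensures.count h.n (fun k s' => ∀ v : Fin I.n, (v : ℕ) < k → (s'.int 14 v ≠ 0 ↔
      classSum I.ends (I.rootedLabel fun u => s.int 15 u ≠ 0) X v ≠ 0)) (by simp) ?_ ?_
  · intro k hk s' hI hf hg
    replace hf : ∀ b, b ≠ 23 → b ≠ 16 → b ≠ 24 → b ≠ 11 → b ≠ 14 → s'.int b = s.int b := by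
      intro b h1 h2 h3 h4 h5
      refine hf b (fun hb => ?_) h1
      have : b ∈ markNonzero.writes := Finset.mem_insert_of_mem hb
      rw [mem_writes_markNonzero] at this
      tauto
    have hl' : Loaded I s' := h.of_eq (fun a ha => hf a (by omega) (by omega) (by omega) (by omega)
      (by omega)) (hg 0 (by simp [groupWrites, sumComponent]))
      (hg 2 (by simp [groupWrites, sumComponent]))
    have h15 : s'.int 15 = s.int 15 := hf 15 (by simp) (by simp) (by simp) (by simp) (by simp)
    have hN' : Names I 7 X (s'.setInt 23 0 k) := hN.of_eq (by
      rw [Memory.int_setInt_of_ne _ (by simp)]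
      exact hf 7 (by simp) (by simp) (by simp) (by simp) (by simp))
    refine Ensures.seq ((ensures_sumComponent (hl'.setInt (by simp) _ _) hN' ⟨k, hk⟩
      (by simp [Memory.setInt])).frame.mono fun s₁ ⟨⟨h1, h2⟩, hf₁, hg₁⟩ => ?_)
    have h14 : s₁.int 14 = s'.int 14 := (hf₁ 14 (by simp [mem_writes_sumComponent])).trans
      (Memory.int_setInt_of_ne _ (by simp) _ _)
    have h23 : s₁.int 23 0 = k := by
      rw [hf₁ 23 (by simp [mem_writes_sumComponent])]; simp [Memory.setInt]
    have hiff := I.classSum_rootedLabel_ne_zero_iff (fun u => s.int 15 u ≠ 0) X ⟨k, hk⟩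
    rw [Memory.int_setInt_of_ne _ (by simp), h15] at h2
    rw [← h2, ← h1] at hiff
    have hfin : ∀ s'' : Memory Γ, (∀ v : Fin I.n, (v : ℕ) ≠ k → s''.int 14 v = s₁.int 14 v) →
        (s''.int 14 k ≠ 0 ↔ s₁.grp 1 0 ≠ 0 ∨ s₁.int 16 0 ≠ 0) → ∀ v : Fin I.n, (v : ℕ) < k + 1 →
        (s''.int 14 v ≠ 0 ↔
          classSum I.ends (I.rootedLabel fun u => s.int 15 u ≠ 0) X v ≠ 0) := by
      intro s'' h3 h4 v hvk
      by_cases hv : (v : ℕ) = k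
      · obtain rfl : v = ⟨k, hk⟩ := Fin.ext hv
        rw [hiff]; exact h4
      · rw [h3 v hv, h14]; exact hI v (by omega)
    refine Ensures.seq (Ensures.groupIsZero ?_ (Ensures.branch (fun hx => Ensures.set ?_)
      fun hx => Ensures.set ?_))
    · rw [show ((Expr.const 0).val s₁).toNat = 0 from rfl, h1]
      exact ⟨_, rfl⟩
    · have hz : s₁.grp 1 0 = 0 := by
        by_contra hz; simp [Expr.val, Memory.setInt, hz] at hx
      apply hfin
      · intro v hv
        simp [Expr.val, Memory.setInt, h23, hv]
      · simp [Expr.val, Memory.setInt, h23, hz]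
    · have hz : s₁.grp 1 0 ≠ 0 := by
        intro hz; simp [Expr.val, Memory.setInt, hz] at hx
      apply hfin
      · intro v hv
        simp [Expr.val, Memory.setInt, h23, hv]
      · simp [Expr.val, Memory.setInt, h23, hz]
  · intro s' hI v
    rw [Memory.int_setInt_of_ne _ (by simp)]
    exact hI v v.2

theorem ensures_searchMarked (h : Loaded I s) {Z : Set (Fin I.m)} (hN : Names I 8 Z s)
    (v : Fin I.n) (hv : s.int 25 0 = (v : ℕ)) :
    searchMarked.Ensures I.sums s fun s' =>
      s'.int 16 0 ≠ 0 ↔ ∃ u : Fin I.n, Conn I.ends Z v u ∧ s.int 14 u ≠ 0 := by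
  refine Ensures.seq (Ensures.set ?_)
  refine Ensures.count (N := I.n) (by simpa [Memory.setInt] using h.n)
    (fun k s' => s'.int 16 0 ≠ 0 ↔
      ∃ u : Fin I.n, (u : ℕ) < k ∧ Conn I.ends Z v u ∧ s.int 14 u ≠ 0) ?_ ?_ ?_
  · simp [Memory.setInt, Expr.val]
  · intro k hk s' hI hf _
    have h8 : s'.int 8 = s.int 8 := (hf 8 (by simp [writes]) (by simp)).trans
      (Memory.int_setInt_of_ne _ (by simp) _ _)
    have h14 : s'.int 14 = s.int 14 := (hf 14 (by simp [writes]) (by simp)).trans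
      (Memory.int_setInt_of_ne _ (by simp) _ _)
    have h25 : s'.int 25 = s.int 25 := (hf 25 (by simp [writes]) (by simp)).trans
      (Memory.int_setInt_of_ne _ (by simp) _ _)
    have hcon : s.int 8 k = s.int 8 v ↔ Conn I.ends Z v ⟨k, hk⟩ :=
      (hN ⟨k, hk⟩ v).trans ⟨Conn.symm, Conn.symm⟩
    have hno : ¬ (Conn I.ends Z v ⟨k, hk⟩ ∧ s.int 14 k ≠ 0) →
        ((s'.setInt 26 0 k).int 16 0 ≠ 0 ↔
          ∃ u : Fin I.n, (u : ℕ) < k + 1 ∧ Conn I.ends Z v u ∧ s.int 14 u ≠ 0) := by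
      intro hn
      rw [Memory.int_setInt_of_ne _ (by simp), hI]
      refine exists_congr fun u => and_congr_left fun h3 => ?_
      have : (u : ℕ) ≠ k := by
        intro huk
        obtain rfl : u = ⟨k, hk⟩ := Fin.ext huk
        exact hn h3
      omega
    refine Ensures.branch (fun hx => Ensures.branch (fun hy => Ensures.set ?_)
      fun hy => Ensures.nop (hno ?_)) fun hx => Ensures.nop (hno ?_)
    · have hc : Conn I.ends Z v ⟨k, hk⟩ := by
        rw [← hcon]; simpa [Expr.val, Memory.setInt, h8, h25, hv] using hx
      have hm : s.int 14 k ≠ 0 := by simpa [Expr.val, Memory.setInt, h14] using hy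
      have : ∃ u : Fin I.n, (u : ℕ) < k + 1 ∧ Conn I.ends Z v u ∧ s.int 14 u ≠ 0 :=
        ⟨⟨k, hk⟩, by simp, hc, hm⟩
      simpa [Expr.val, Memory.setInt] using this
    · have hm : s.int 14 k = 0 := by simpa [Expr.val, Memory.setInt, h14] using hy
      exact fun h3 => h3.2 hm
    · have hc : ¬ Conn I.ends Z v ⟨k, hk⟩ := by
        rw [← hcon]; simpa [Expr.val, Memory.setInt, h8, h25, hv] using hx
      exact fun h3 => hc h3.1
  · intro s' hI
    rw [Memory.int_setInt_of_ne _ (by simp), hI]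
    simp

theorem ensures_testSeparable (h : Loaded I s) :
    testSeparable.Ensures I.sums s fun s' => s'.int 17 0 ≠ 0 ↔
      Separable I.ends (I.rootedLabel fun u => s.int 15 u ≠ 0)
        {e : Fin I.m | s.int 5 e = 1} {e : Fin I.m | s.int 6 e = 0} := by
  set X := {e : Fin I.m | s.int 5 e = 1} with hX
  set Z := {e : Fin I.m | s.int 6 e = 0} with hZ
  refine Ensures.seq ((ensures_findComponents (Or.inl rfl) h).frame.mono
    fun s₁ ⟨⟨hN₁, hac₁⟩, hf₁, hg₁⟩ => ?_)
  rw [groupWrites_findComponents] at hg₁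
  simp only [mem_writes_findComponents] at hf₁
  have hl₁ : Loaded I s₁ := h.of_eq (fun a ha => hf₁ a (by omega)) (hg₁ 0 (by simp))
    (hg₁ 2 (by simp))
  refine Ensures.seq ((ensures_findComponents (Or.inr rfl) hl₁).frame.mono
    fun s₂ ⟨⟨hN₂, _⟩, hf₂, hg₂⟩ => ?_)
  rw [groupWrites_findComponents] at hg₂
  simp only [mem_writes_findComponents] at hf₂
  have hl₂ : Loaded I s₂ := hl₁.of_eq (fun a ha => hf₂ a (by omega)) (hg₂ 0 (by simp))
    (hg₂ 2 (by simp))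
  rw [hf₁ _ (by simp)] at hN₂
  refine Ensures.seq ((ensures_markNonzero hl₂ (hN₁.of_eq (hf₂ 7 (by simp)))).frame.mono
    fun s₃ ⟨hM, hf₃, hg₃⟩ => ?_)
  simp only [mem_writes_markNonzero] at hf₃
  have hl₃ : Loaded I s₃ := hl₂.of_eq (fun a ha => hf₃ a (by omega))
    (hg₃ 0 (by simp [markNonzero, sumComponent, groupWrites]))
    (hg₃ 2 (by simp [markNonzero, sumComponent, groupWrites]))
  rw [hf₂ 15 (by simp), hf₁ 15 (by simp)] at hM
  have hN₃ : Names I 8 Z s₃ := hN₂.of_eq (hf₃ 8 (by simp))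
  have hac₃ : s₃.int 9 0 ≠ 0 ↔ Acyc I.ends X := by
    rw [hf₃ 9 (by simp), hf₂ 9 (by simp)]; exact hac₁
  refine Ensures.seq (Ensures.set (Ensures.count (N := I.n)
    (by simpa [Memory.setInt] using hl₃.n)
    (fun k s' => s'.int 17 0 ≠ 0 ↔ Acyc I.ends X ∧ ∀ v : Fin I.n, (v : ℕ) < k →
      ∃ u : Fin I.n, Conn I.ends Z v u ∧ s₃.int 14 u ≠ 0) ?_ ?_ ?_))
  · simpa [Memory.setInt, Expr.val] using hac₃
  · intro k hk s' hI hf hg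
    replace hf : ∀ b, b ≠ 16 → b ≠ 26 → b ≠ 17 → b ≠ 25 → s'.int b = s₃.int b := by
      intro b h1 h2 h3 h4
      refine (hf b ?_ h4).trans (Memory.int_setInt_of_ne _ h3 _ _)
      simp only [writes, Finset.mem_union, mem_writes_searchMarked, Finset.mem_singleton,
        Finset.notMem_empty]
      tauto
    have hl' : Loaded I s' := hl₃.of_eq (fun a ha => hf a (by omega) (by omega) (by omega)
      (by omega)) (hg 0 (by simp [groupWrites, searchMarked]))
      (hg 2 (by simp [groupWrites, searchMarked]))
    refine Ensures.seq ((ensures_searchMarked (hl'.setInt (by simp) _ _) (hN₃.of_eq ?_) ⟨k, hk⟩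
      (by simp [Memory.setInt])).frame.mono fun s₄ ⟨h1, hf₄, _⟩ => ?_)
    · rw [Memory.int_setInt_of_ne _ (by simp)]
      exact hf 8 (by simp) (by simp) (by simp) (by simp)
    rw [Memory.int_setInt_of_ne _ (by simp), hf 14 (by simp) (by simp) (by simp) (by simp)] at h1
    have h17 : s₄.int 17 0 = s'.int 17 0 := by
      rw [hf₄ 17 (by simp [mem_writes_searchMarked]), Memory.int_setInt_of_ne _ (by simp)]
    refine Ensures.branch (fun hx => Ensures.nop ?_) fun hx => Ensures.set ?_
    · have hx' := h1.1 hx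
      rw [h17, hI]
      refine and_congr_right fun _ => ⟨fun h3 v hv => ?_, fun h3 v hv => h3 v (by omega)⟩
      by_cases hvk : (v : ℕ) = k
      · obtain rfl : v = ⟨k, hk⟩ := Fin.ext hvk
        exact hx'
      · exact h3 v (by omega)
    · have hx' : ¬ _ := fun h3 => (h1.2 h3) hx
      have : ¬ (Acyc I.ends X ∧ ∀ v : Fin I.n, (v : ℕ) < k + 1 →
          ∃ u : Fin I.n, Conn I.ends Z v u ∧ s₃.int 14 u ≠ 0) :=
        fun h3 => hx' (h3.2 ⟨k, hk⟩ (by simp))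
      simpa [Memory.setInt, Expr.val] using this
  · intro s' hI
    rw [Memory.int_setInt_of_ne _ (by simp), hI]
    simp only [Fin.is_lt, forall_const, Separable, hM]
    rfl

theorem ensures_findRoots (h : Loaded I s) (h6 : ∀ i, s.int 6 i = 0) (h15 : ∀ i, s.int 15 i = 0) :
    findRoots.Ensures I.sums s fun s' => I.IsRoots fun v => s'.int 15 v ≠ 0 := by
  refine Ensures.seq ((ensures_findComponents (Or.inr rfl) h).frame.mono
    fun s₁ ⟨⟨hN₁, _⟩, hf₁, hg₁⟩ => ?_)
  rw [groupWrites_findComponents] at hg₁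
  simp only [mem_writes_findComponents] at hf₁
  have hl₁ : Loaded I s₁ := h.of_eq (fun a ha => hf₁ a (by omega)) (hg₁ 0 (by simp))
    (hg₁ 2 (by simp))
  have hZ : {e : Fin I.m | s.int (8 - 2) e = 0} = Set.univ := by
    ext e; simp [h6]
  rw [hZ] at hN₁
  refine Ensures.seq ((Ensures.count hl₁.n (fun k s' => ∀ v : Fin I.n, (v : ℕ) < k →
    (s'.int 14 v ≠ 0 ↔ I.label v ≠ 0)) (Q := fun s' => ∀ v : Fin I.n,
      s'.int 14 v ≠ 0 ↔ I.label v ≠ 0) (by simp) ?_ ?_).frame.mono fun s₂ ⟨hM, hf₂, hg₂⟩ => ?_)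
  · intro k hk s' hI _ hg
    have hlab : s'.grp 0 k = I.label ⟨k, hk⟩ := by
      rw [hg 0 (by simp [groupWrites])]; exact hl₁.label ⟨k, hk⟩
    refine Ensures.seq (Ensures.groupIsZero ?_ (Ensures.set fun v hv => ?_))
    · simpa [Expr.val, Memory.setInt, hlab] using I.label_mem_sums ⟨k, hk⟩
    · by_cases hvk : (v : ℕ) = k
      · obtain rfl : v = ⟨k, hk⟩ := Fin.ext hvk
        by_cases hz : I.label ⟨k, hk⟩ = 0 <;> simp [Expr.val, Memory.setInt, hlab, hz]
      · have := hI v (by omega)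
        simpa [Expr.val, Memory.setInt, hvk] using this
  · intro s' hI v
    rw [Memory.int_setInt_of_ne _ (by simp)]
    exact hI v v.2
  simp only [writes, Finset.mem_insert, Finset.mem_union, Finset.mem_singleton] at hf₂
  have hl₂ : Loaded I s₂ := hl₁.of_eq (fun a ha => hf₂ a (by omega))
    (hg₂ 0 (by simp [groupWrites])) (hg₂ 2 (by simp [groupWrites]))
  have hN₂ : Names I 8 Set.univ s₂ := hN₁.of_eq (hf₂ 8 (by simp))
  have h15' : s₂.int 15 = s.int 15 := by rw [hf₂ 15 (by simp), hf₁ 15 (by simp)]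
  refine Ensures.count hl₂.n (fun k s' =>
    (∀ v : Fin I.n, s'.int 14 v ≠ 0 ↔ I.label v ≠ 0 ∨ s'.int 15 v ≠ 0) ∧
    (∀ v : Fin I.n, (v : ℕ) < k → ∃ u : Fin I.n, Conn I.ends Set.univ v u ∧
      (I.label u ≠ 0 ∨ s'.int 15 u ≠ 0)) ∧
    ∀ v : Fin I.n, s'.int 15 v ≠ 0 → ∀ u : Fin I.n, Conn I.ends Set.univ v u →
      I.label u = 0 ∧ (s'.int 15 u ≠ 0 → u = v)) ?_ ?_ ?_
  · simpa [h15', h15] using hM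
  · intro k hk s' ⟨hI1, hI2, hI3⟩ hf hg
    replace hf : ∀ b, b ≠ 16 → b ≠ 26 → b ≠ 15 → b ≠ 14 → b ≠ 25 → s'.int b = s₂.int b := by
      intro b h1 h2 h3 h4 h5
      refine hf b ?_ h5
      simp only [writes, Finset.mem_union, mem_writes_searchMarked, Finset.mem_singleton,
        Finset.notMem_empty]
      tauto
    have hl' : Loaded I s' := hl₂.of_eq (fun a ha => hf a (by omega) (by omega) (by omega)
      (by omega) (by omega)) (hg 0 (by simp [groupWrites, searchMarked]))
      (hg 2 (by simp [groupWrites, searchMarked]))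
    refine Ensures.seq ((ensures_searchMarked (hl'.setInt (by simp) _ _) (hN₂.of_eq ?_) ⟨k, hk⟩
      (by simp [Memory.setInt])).frame.mono fun s₄ ⟨h1, hf₄, _⟩ => ?_)
    · rw [Memory.int_setInt_of_ne _ (by simp)]
      exact hf 8 (by simp) (by simp) (by simp) (by simp) (by simp)
    simp only [mem_writes_searchMarked] at hf₄
    rw [Memory.int_setInt_of_ne _ (by simp)] at h1
    simp only [hI1] at h1
    have h14 : s₄.int 14 = s'.int 14 := by
      rw [hf₄ 14 (by simp), Memory.int_setInt_of_ne _ (by simp)]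
    have h15 : s₄.int 15 = s'.int 15 := by
      rw [hf₄ 15 (by simp), Memory.int_setInt_of_ne _ (by simp)]
    have h25 : s₄.int 25 0 = k := by
      rw [hf₄ 25 (by simp)]; simp [Memory.setInt]
    refine Ensures.branch (fun hx => Ensures.nop ?_) fun hx =>
      Ensures.seq (Ensures.set (Ensures.set ?_))
    · have hx' := h1.1 hx
      rw [h14, h15]
      refine ⟨hI1, fun v hv => ?_, hI3⟩
      by_cases hvk : (v : ℕ) = k
      · obtain rfl : v = ⟨k, hk⟩ := Fin.ext hvk
        exact hx'
      · exact hI2 v (by omega)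
    · have hx' : ∀ u : Fin I.n, Conn I.ends Set.univ ⟨k, hk⟩ u →
          I.label u = 0 ∧ s'.int 15 u = 0 := by
        intro u hu
        by_contra hc
        exact h1.2 ⟨u, hu, by tauto⟩ hx
      set s₅ := (s₄.setInt 15 ((entry 25).val s₄).toNat ((Expr.const 1).val s₄)) with hs₅
      set s₆ := s₅.setInt 14 ((entry 25).val s₅).toNat ((Expr.const 1).val s₅) with hs₆
      have e14 : ∀ v : Fin I.n, s₆.int 14 v ≠ 0 ↔ s'.int 14 v ≠ 0 ∨ v = ⟨k, hk⟩ := by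
        intro v
        rw [← h14, Fin.ext_iff]
        by_cases hvk : (v : ℕ) = k <;> simp [hs₆, hs₅, Memory.setInt, Expr.val, h25, hvk]
      have e15 : ∀ v : Fin I.n, s₆.int 15 v ≠ 0 ↔ s'.int 15 v ≠ 0 ∨ v = ⟨k, hk⟩ := by
        intro v
        rw [← h15, Fin.ext_iff]
        by_cases hvk : (v : ℕ) = k <;> simp [hs₆, hs₅, Memory.setInt, Expr.val, h25, hvk]
      simp only [e14, e15]
      refine ⟨fun v => by rw [hI1]; tauto, fun v hv => ?_, ?_⟩
      · by_cases hvk : (v : ℕ) = k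
        · exact ⟨v, Conn.refl v, Or.inr (Or.inr (Fin.ext hvk))⟩
        · obtain ⟨u, hu, h3⟩ := hI2 v (by omega)
          exact ⟨u, hu, by tauto⟩
      · rintro v (hv | rfl) u hu
        · refine ⟨(hI3 v hv u hu).1, ?_⟩
          rintro (h3 | rfl)
          · exact (hI3 v hv u hu).2 h3
          · exact (hv (hx' v hu.symm).2).elim
        · refine ⟨(hx' u hu).1, ?_⟩
          rintro (h3 | h3)
          · exact (h3 (hx' u hu).2).elim
          · exact h3
  · rintro s' ⟨_, hI2, hI3⟩
    rw [Memory.int_setInt_of_ne _ (by simp)]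
    exact ⟨fun v => hI2 v v.2, hI3⟩

theorem ensures_absWeights (h : Loaded I s) :
    absWeights.Ensures I.sums s fun s' => ∀ e : Fin I.m, s'.int 13 e = |(I.weight e).num| := by
  refine Ensures.count h.m (fun k s' => ∀ e : Fin I.m, (e : ℕ) < k →
    s'.int 13 e = |(I.weight e).num|) (by simp) ?_ ?_
  · intro k hk s' hI hf _
    have h3 : s'.int 3 k = (I.weight ⟨k, hk⟩).num := by
      rw [hf 3 (by simp [writes]) (by simp)]; exact h.num ⟨k, hk⟩
    refine Ensures.branch (fun hx => Ensures.set fun e he => ?_) fun hx => Ensures.set fun e he => ?_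
    · have hneg : (I.weight ⟨k, hk⟩).num < 0 := by
        simpa [Expr.val, Memory.setInt, h3] using hx
      by_cases hek : (e : ℕ) = k
      · obtain rfl : e = ⟨k, hk⟩ := Fin.ext hek
        simp [Expr.val, Memory.setInt, h3, abs_of_neg hneg]
      · have := hI e (by omega)
        simpa [Expr.val, Memory.setInt, hek] using this
    · have hneg : 0 ≤ (I.weight ⟨k, hk⟩).num := by
        simpa [Expr.val, Memory.setInt, h3] using hx
      by_cases hek : (e : ℕ) = k
      · obtain rfl : e = ⟨k, hk⟩ := Fin.ext hek
        simp [Expr.val, Memory.setInt, h3, abs_of_nonneg hneg]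
      · have := hI e (by omega)
        simpa [Expr.val, Memory.setInt, hek] using this
  · intro s' hI e
    rw [Memory.int_setInt_of_ne _ (by simp)]
    exact hI e e.2

theorem abs_lt_abs_iff_num_mul_den (x y : ℚ) :
    |x| < |y| ↔ |x.num| * (y.den : ℤ) < |y.num| * (x.den : ℤ) := by
  have hx : |x| = (|x.num| : ℤ) / (x.den : ℚ) := by
    conv_lhs => rw [← Rat.num_div_den x]
    rw [abs_div, Nat.abs_cast, Int.cast_abs]
  have hy : |y| = (|y.num| : ℤ) / (y.den : ℚ) := by
    conv_lhs => rw [← Rat.num_div_den y]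
    rw [abs_div, Nat.abs_cast, Int.cast_abs]
  rw [hx, hy, div_lt_div_iff₀ (by exact_mod_cast x.den_pos) (by exact_mod_cast y.den_pos)]
  exact_mod_cast Iff.rfl

theorem ensures_selectEdge (h : Loaded I s)
    (h13 : ∀ e : Fin I.m, s.int 13 e = |(I.weight e).num|) :
    selectEdge.Ensures I.sums s fun s' =>
      (s'.int 18 0 = 0 → ∀ e : Fin I.m, ¬ (s.int 5 e = 0 ∧ s.int 6 e = 0)) ∧
      (s'.int 18 0 ≠ 0 → ∃ b : Fin I.m, s'.int 19 0 = (b : ℕ) ∧ s.int 5 b = 0 ∧ s.int 6 b = 0 ∧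
        ∀ e : Fin I.m, s.int 5 e = 0 → s.int 6 e = 0 → |I.weight e| ≤ |I.weight b|) := by
  refine Ensures.seq (Ensures.set (Ensures.count (N := I.m)
    (by simpa [Memory.setInt] using h.m)
    (fun k s' => (s'.int 18 0 = 0 → ∀ e : Fin I.m, (e : ℕ) < k →
        ¬ (s.int 5 e = 0 ∧ s.int 6 e = 0)) ∧
      (s'.int 18 0 ≠ 0 → ∃ b : Fin I.m, s'.int 19 0 = (b : ℕ) ∧ s.int 5 b = 0 ∧ s.int 6 b = 0 ∧
        ∀ e : Fin I.m, (e : ℕ) < k → s.int 5 e = 0 → s.int 6 e = 0 →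
          |I.weight e| ≤ |I.weight b|)) ?_ ?_ ?_))
  · simp [Memory.setInt, Expr.val]
  · intro k hk s' ⟨hI1, hI2⟩ hf _
    have hfr : ∀ b, b ≠ 18 → b ≠ 19 → b ≠ 20 → s'.int b = s.int b := by
      intro b h1 h2 h3
      exact (hf b (by simp [writes, h1, h2]) h3).trans (Memory.int_setInt_of_ne _ h1 _ _)
    have h5 := hfr 5 (by simp) (by simp) (by simp)
    have h6 := hfr 6 (by simp) (by simp) (by simp)
    have h13' := hfr 13 (by simp) (by simp) (by simp)
    have h4 := hfr 4 (by simp) (by simp) (by simp)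
    have hskip : ¬ (s.int 5 k = 0 ∧ s.int 6 k = 0) → ((s'.setInt 20 0 k).int 18 0 = 0 →
        ∀ e : Fin I.m, (e : ℕ) < k + 1 → ¬ (s.int 5 e = 0 ∧ s.int 6 e = 0)) ∧
      ((s'.setInt 20 0 k).int 18 0 ≠ 0 → ∃ b : Fin I.m, (s'.setInt 20 0 k).int 19 0 = (b : ℕ) ∧
        s.int 5 b = 0 ∧ s.int 6 b = 0 ∧ ∀ e : Fin I.m, (e : ℕ) < k + 1 → s.int 5 e = 0 →
          s.int 6 e = 0 → |I.weight e| ≤ |I.weight b|) := by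
      intro hn
      rw [Memory.int_setInt_of_ne _ (by simp), Memory.int_setInt_of_ne _ (by simp)]
      have hlt : ∀ e : Fin I.m, (e : ℕ) < k + 1 → s.int 5 e = 0 ∧ s.int 6 e = 0 → (e : ℕ) < k := by
        intro e he h'
        have : (e : ℕ) ≠ k := by rintro rfl; exact hn h'
        omega
      refine ⟨fun h0 e he h' => hI1 h0 e (hlt e he h') h', fun h0 => ?_⟩
      obtain ⟨b, hb1, hb2, hb3, hb4⟩ := hI2 h0
      exact ⟨b, hb1, hb2, hb3, fun e he h5 h6 => hb4 e (hlt e he ⟨h5, h6⟩) h5 h6⟩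
    refine Ensures.branch (fun hx => Ensures.branch (fun hy => ?_) fun hy => Ensures.nop (hskip ?_))
      fun hx => Ensures.nop (hskip ?_)
    · have hk5 : s.int 5 k = 0 := by simpa [Expr.val, Memory.setInt, h5] using hx
      have hk6 : s.int 6 k = 0 := by simpa [Expr.val, Memory.setInt, h6] using hy
      refine Ensures.branch (fun hz => ?_) fun hz =>
        Ensures.seq (Ensures.set (Ensures.set ⟨fun h0 => ?_, fun _ => ⟨⟨k, hk⟩, ?_, hk5, hk6, ?_⟩⟩))
      · have hz' : s'.int 18 0 ≠ 0 := by simpa [Expr.val, Memory.setInt] using hz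
        obtain ⟨b, hb1, hb2, hb3, hb4⟩ := hI2 hz'
        have hcmp : (Expr.lt (.mul (.get 13 (entry 19)) (.get 4 (entry 20)))
              (.mul (.get 13 (entry 20)) (.get 4 (entry 19)))).val (s'.setInt 20 0 k) ≠ 0 ↔
            |I.weight b| < |I.weight ⟨k, hk⟩| := by
          rw [abs_lt_abs_iff_num_mul_den, ← h13, ← h13, ← h.den, ← h.den]
          simp [Expr.val, Memory.setInt, h13', h4, hb1]
        refine Ensures.branch (fun hw => Ensures.set ?_) fun hw => Ensures.nop ?_
        · have hw' := hcmp.1 hw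
          refine ⟨fun h0 => ?_, fun _ => ⟨⟨k, hk⟩, ?_, hk5, hk6, ?_⟩⟩
          · exact (hz' (by simpa [Memory.setInt] using h0)).elim
          · simp [Expr.val, Memory.setInt]
          · intro e he h5 h6
            by_cases hek : (e : ℕ) = k
            · rw [show e = ⟨k, hk⟩ from Fin.ext hek]
            · exact (hb4 e (by omega) h5 h6).trans hw'.le
        · have hw' : |I.weight ⟨k, hk⟩| ≤ |I.weight b| := not_lt.1 fun h' => hcmp.2 h' hw
          refine ⟨fun h0 => ?_, fun _ => ⟨b, ?_, hb2, hb3, ?_⟩⟩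
          · exact (hz' (by simpa [Memory.setInt] using h0)).elim
          · simpa [Expr.val, Memory.setInt] using hb1
          · intro e he h5 h6
            by_cases hek : (e : ℕ) = k
            · rwa [show e = ⟨k, hk⟩ from Fin.ext hek]
            · exact hb4 e (by omega) h5 h6
      · simp [Expr.val, Memory.setInt] at h0
      · simp [Expr.val, Memory.setInt]
      · have hz' : s'.int 18 0 = 0 := by simpa [Expr.val, Memory.setInt] using hz
        intro e he h5 h6
        by_cases hek : (e : ℕ) = k
        · rw [show e = ⟨k, hk⟩ from Fin.ext hek]
        · exact (hI1 hz' e (by omega) ⟨h5, h6⟩).elim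
    · have hk6 : s.int 6 k ≠ 0 := by simpa [Expr.val, Memory.setInt, h6] using hy
      exact fun h' => hk6 h'.2
    · have hk5 : s.int 5 k ≠ 0 := by simpa [Expr.val, Memory.setInt, h5] using hx
      exact fun h' => hk5 h'.1
  · rintro s' ⟨hI1, hI2⟩
    rw [Memory.int_setInt_of_ne _ (by simp), Memory.int_setInt_of_ne _ (by simp)]
    refine ⟨fun h0 e => hI1 h0 e e.2, fun h0 => ?_⟩
    obtain ⟨b, hb1, hb2, hb3, hb4⟩ := hI2 h0
    exact ⟨b, hb1, hb2, hb3, fun e => hb4 e e.2⟩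

end Verification

section InputLength

variable {Γ : Type*} {I : Input Γ}

theorem Input.n_le_length (T : GroupCosts Γ) : I.n ≤ I.length T := by
  have : ∑ _v : Fin I.n, 1 ≤ ∑ v, (T.codeLength (I.label v) + 1) :=
    Finset.sum_le_sum fun _ _ => Nat.le_add_left _ _
  simp only [Finset.sum_const, Finset.card_univ, Fintype.card_fin, smul_eq_mul, mul_one] at this
  exact this.trans (Nat.le_add_right _ _)

theorem Input.edge_length_le (T : GroupCosts Γ) (e : Fin I.m) :
    Nat.size (I.ends e).1 + Nat.size (I.ends e).2 + Nat.size (I.weight e).num.natAbs +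
      Nat.size (I.weight e).den + 4 ≤ I.length T :=
  (Finset.single_le_sum (f := fun e : Fin I.m => Nat.size (I.ends e).1 + Nat.size (I.ends e).2 +
    Nat.size (I.weight e).num.natAbs + Nat.size (I.weight e).den + 4) (fun _ _ => Nat.zero_le _)
      (Finset.mem_univ e)).trans (Nat.le_add_left _ _)

theorem Input.m_le_length (T : GroupCosts Γ) : I.m ≤ I.length T := by
  have : ∑ _e : Fin I.m, 1 ≤ ∑ e, (Nat.size (I.ends e).1 + Nat.size (I.ends e).2 +
      Nat.size (I.weight e).num.natAbs + Nat.size (I.weight e).den + 4) :=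
    Finset.sum_le_sum fun _ _ => by omega
  simp only [Finset.sum_const, Finset.card_univ, Fintype.card_fin, smul_eq_mul, mul_one] at this
  exact this.trans (Nat.le_add_left _ _)

end InputLength

section Correctness

open Cmd

variable {Γ : Type*} [AddCommGroup Γ] {I : Input Γ} {s : Memory Γ}

/-- The invariant of the greedy algorithm. -/
structure GreedyState (I : Input Γ) (R : Fin I.n → Prop) (s : Memory Γ) : Prop where
  loaded : Loaded I s
  abs : ∀ e : Fin I.m, s.int 13 e = |(I.weight e).num|
  roots : (fun u : Fin I.n => s.int 15 u ≠ 0) = R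
  bit_in : ∀ e : Fin I.m, s.int 5 e = 0 ∨ s.int 5 e = 1
  bit_out : ∀ e : Fin I.m, s.int 6 e = 0 ∨ s.int 6 e = 1
  extendable : Extendable I.ends (I.rootedLabel R) I.weight
    {e : Fin I.m | s.int 5 e = 1} {e : Fin I.m | s.int 6 e = 0}

/-- The edges that are neither put in nor left out. -/
def undecided (I : Input Γ) (s : Memory Γ) : Finset (Fin I.m) :=
  {e : Fin I.m | s.int 5 e = 0 ∧ s.int 6 e = 0}

variable {R : Fin I.n → Prop}

/-- Deciding one edge preserves the invariant. -/
theorem GreedyState.decide_edge {s' : Memory Γ} (h : GreedyState I R s) (b : Fin I.m)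
    (h13 : s'.int 13 = s.int 13) (h15 : s'.int 15 = s.int 15) (hl : Loaded I s')
    (hb5 : s.int 5 b = 0) (hb6 : s.int 6 b = 0)
    (hne : ∀ e : Fin I.m, e ≠ b → s'.int 5 e = s.int 5 e ∧ s'.int 6 e = s.int 6 e)
    (hb : (s'.int 5 b = 1 ∧ s'.int 6 b = 0 ∧
        Extendable I.ends (I.rootedLabel R) I.weight
          (insert b {e : Fin I.m | s.int 5 e = 1}) {e : Fin I.m | s.int 6 e = 0}) ∨
      (s'.int 5 b = 0 ∧ s'.int 6 b = 1 ∧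
        Extendable I.ends (I.rootedLabel R) I.weight
          {e : Fin I.m | s.int 5 e = 1} ({e : Fin I.m | s.int 6 e = 0} \ {b}))) :
    GreedyState I R s' ∧ undecided I s' ⊆ (undecided I s).erase b := by
  refine ⟨⟨hl, by rw [h13]; exact h.abs, by rw [h15]; exact h.roots, fun e => ?_, fun e => ?_, ?_⟩,
    fun e he => ?_⟩
  · by_cases heb : e = b
    · subst heb; tauto
    · rw [(hne e heb).1]; exact h.bit_in e
  · by_cases heb : e = b
    · subst heb; tauto
    · rw [(hne e heb).2]; exact h.bit_out e
  · rcases hb with ⟨h1, h2, h3⟩ | ⟨h1, h2, h3⟩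
    · have hX : {e : Fin I.m | s'.int 5 e = 1} = insert b {e : Fin I.m | s.int 5 e = 1} := by
        ext e
        by_cases heb : e = b
        · subst heb; simp [h1]
        · simp [heb, (hne e heb).1]
      have hZ : {e : Fin I.m | s'.int 6 e = 0} = {e : Fin I.m | s.int 6 e = 0} := by
        ext e
        by_cases heb : e = b
        · subst heb; simp [h2, hb6]
        · simp [(hne e heb).2]
      rwa [hX, hZ]
    · have hX : {e : Fin I.m | s'.int 5 e = 1} = {e : Fin I.m | s.int 5 e = 1} := by
        ext e
        by_cases heb : e = b
        · subst heb; simp [h1, hb5]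
        · simp [(hne e heb).1]
      have hZ : {e : Fin I.m | s'.int 6 e = 0} = {e : Fin I.m | s.int 6 e = 0} \ {b} := by
        ext e
        by_cases heb : e = b
        · subst heb; simp [h2]
        · simp [heb, (hne e heb).2]
      rwa [hX, hZ]
  · simp only [undecided, Finset.mem_erase, Finset.mem_filter, Finset.mem_univ, true_and] at he ⊢
    have heb : e ≠ b := by rintro rfl; rcases hb with hb | hb <;> omega
    rw [(hne e heb).1, (hne e heb).2] at he
    exact ⟨heb, he⟩

theorem ensures_decideEdge (h : GreedyState I R s)
    (h0 : s.int 18 0 = 0 → undecided I s = ∅)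
    (h1 : s.int 18 0 ≠ 0 → ∃ b : Fin I.m, s.int 19 0 = (b : ℕ) ∧ b ∈ undecided I s ∧
      ∀ e ∈ undecided I s, |I.weight e| ≤ |I.weight b|) :
    decideEdge.Ensures I.sums s fun s' => GreedyState I R s' ∧
      (undecided I s').card ≤ (undecided I s).card - 1 := by
  refine Ensures.branch (fun hx => ?_) fun hx => Ensures.nop ⟨h, by
    rw [h0 (by simpa [Expr.val] using hx)]; simp⟩
  obtain ⟨b, hb, hbu, hmax⟩ := h1 (by simpa [Expr.val] using hx)
  suffices hs : (branch (.lt (.get 3 (entry 19)) (.const 0)) (tryEdge 6 5) (tryEdge 5 6)).Ensures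
      I.sums s fun s' => GreedyState I R s' ∧ undecided I s' ⊆ (undecided I s).erase b by
    refine hs.mono fun s' hs' => ⟨hs'.1, ?_⟩
    rw [← Finset.card_erase_of_mem hbu]
    exact Finset.card_le_card hs'.2
  simp only [undecided, Finset.mem_filter, Finset.mem_univ, true_and] at hbu
  obtain ⟨hb5, hb6⟩ := hbu
  have hmax' : ∀ f ∈ {e : Fin I.m | s.int 6 e = 0}, f ∉ {e : Fin I.m | s.int 5 e = 1} →
      |I.weight f| ≤ |I.weight b| := fun f hf6 hf5 =>
    hmax f (by simpa [undecided] using ⟨(h.bit_in f).resolve_right hf5, hf6⟩)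
  have hbX : b ∉ {e : Fin I.m | s.int 5 e = 1} := by simp [hb5]
  have hsign : (Expr.lt (.get 3 (entry 19)) (.const 0)).val s ≠ 0 ↔ I.weight b < 0 := by
    rw [← Rat.num_neg, ← h.loaded.num]
    simp [Expr.val, hb]
  have hb19 : ((entry 19).val s).toNat = b := by simp [Expr.val, hb]
  have hfr : ∀ (s₁ s₂ : Memory Γ) (a : ℕ), (∀ a ∉ testSeparable.writes, s₂.int a = s₁.int a) →
      a < 7 ∨ a = 13 ∨ a = 15 ∨ a = 19 → s₂.int a = s₁.int a := by
    intro s₁ s₂ a hf ha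
    exact hf a (by rw [mem_writes_testSeparable]; omega)
  refine Ensures.branch (fun hw => ?_) fun hw => ?_
  · have hw' := hsign.1 hw
    refine Ensures.seq (Ensures.set ?_)
    rw [hb19, show (Expr.const 1).val s = 1 from rfl]
    have hl₁ : Loaded I (s.setInt 6 b 1) := h.loaded.setInt (by simp) _ _
    refine Ensures.seq ((ensures_testSeparable hl₁).frame.mono fun s₂ ⟨h17, hf, hg⟩ => ?_)
    replace hf := fun a => hfr _ s₂ a hf
    rw [groupWrites_testSeparable] at hg
    have hl₂ : Loaded I s₂ := hl₁.of_eq (fun a ha => hf a (by omega)) (hg 0 (by simp))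
      (hg 2 (by simp))
    have hZ : {e : Fin I.m | (s.setInt 6 b 1).int 6 e = 0} =
        {e : Fin I.m | s.int 6 e = 0} \ {b} := by
      ext e
      by_cases heb : e = b
      · subst heb; simp [Memory.setInt]
      · have : (e : ℕ) ≠ b := fun h' => heb (Fin.ext h')
        simp [Memory.setInt, heb, this]
    rw [Memory.int_setInt_of_ne _ (by simp), Memory.int_setInt_of_ne _ (by simp), h.roots,
      hZ] at h17
    have hb19' : ((entry 19).val s₂).toNat = b := by
      simp [Expr.val, hf 19 (by simp), Memory.setInt, hb]
    have hne : ∀ e : Fin I.m, e ≠ b → s₂.int 5 e = s.int 5 e ∧ s₂.int 6 e = s.int 6 e := by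
      intro e heb
      have : (e : ℕ) ≠ b := fun h' => heb (Fin.ext h')
      simp [hf 5 (by simp), hf 6 (by simp), Memory.setInt, this]
    refine Ensures.branch (fun hy => Ensures.nop ?_) fun hy =>
      Ensures.seq (Ensures.set (Ensures.set ?_))
    · have hsep := h17.1 hy
      refine h.decide_edge b ((hf 13 (by simp)).trans (Memory.int_setInt_of_ne _ (by simp) _ _))
        ((hf 15 (by simp)).trans (Memory.int_setInt_of_ne _ (by simp) _ _)) hl₂ hb5 hb6 hne
        (Or.inr ⟨?_, ?_, h.extendable.sdiff_edge hbX hw' hmax' hsep⟩)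
      · simp [hf 5 (by simp), Memory.setInt, hb5]
      · simp [hf 6 (by simp), Memory.setInt]
    · have hsep : ¬ _ := fun h' => (h17.2 h') hy
      have hb19'' : ((entry 19).val (s₂.setInt 6 b 0)).toNat = b := by
        rw [← hb19']; simp [Expr.val, Memory.setInt]
      rw [hb19', show (Expr.const 0).val s₂ = 0 from rfl, hb19'',
        show (Expr.const 1).val (s₂.setInt 6 b 0) = 1 from rfl]
      refine h.decide_edge b ?_ ?_ ((hl₂.setInt (by simp) _ _).setInt (by simp) _ _) hb5 hb6 ?_
        (Or.inl ⟨?_, ?_, h.extendable.insert_of_not hsep⟩)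
      · simp [Memory.int_setInt_of_ne, hf 13]
      · simp [Memory.int_setInt_of_ne, hf 15]
      · intro e heb
        have : (e : ℕ) ≠ b := fun h' => heb (Fin.ext h')
        simpa [Memory.setInt, this] using hne e heb
      · simp [Memory.setInt]
      · simp [Memory.setInt]
  · have hw' : 0 ≤ I.weight b := not_lt.1 fun h' => hsign.2 h' hw
    refine Ensures.seq (Ensures.set ?_)
    rw [hb19, show (Expr.const 1).val s = 1 from rfl]
    have hl₁ : Loaded I (s.setInt 5 b 1) := h.loaded.setInt (by simp) _ _
    refine Ensures.seq ((ensures_testSeparable hl₁).frame.mono fun s₂ ⟨h17, hf, hg⟩ => ?_)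
    replace hf := fun a => hfr _ s₂ a hf
    rw [groupWrites_testSeparable] at hg
    have hl₂ : Loaded I s₂ := hl₁.of_eq (fun a ha => hf a (by omega)) (hg 0 (by simp))
      (hg 2 (by simp))
    have hX : {e : Fin I.m | (s.setInt 5 b 1).int 5 e = 1} =
        insert b {e : Fin I.m | s.int 5 e = 1} := by
      ext e
      by_cases heb : e = b
      · subst heb; simp [Memory.setInt]
      · have : (e : ℕ) ≠ b := fun h' => heb (Fin.ext h')
        simp [Memory.setInt, heb, this]
    rw [Memory.int_setInt_of_ne _ (b := 15) (by simp), h.roots, hX,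
      Memory.int_setInt_of_ne _ (by simp)] at h17
    have hb19' : ((entry 19).val s₂).toNat = b := by
      simp [Expr.val, hf 19 (by simp), Memory.setInt, hb]
    have hne : ∀ e : Fin I.m, e ≠ b → s₂.int 5 e = s.int 5 e ∧ s₂.int 6 e = s.int 6 e := by
      intro e heb
      have : (e : ℕ) ≠ b := fun h' => heb (Fin.ext h')
      simp [hf 5 (by simp), hf 6 (by simp), Memory.setInt, this]
    refine Ensures.branch (fun hy => Ensures.nop ?_) fun hy =>
      Ensures.seq (Ensures.set (Ensures.set ?_))
    · have hsep := h17.1 hy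
      refine h.decide_edge b ((hf 13 (by simp)).trans (Memory.int_setInt_of_ne _ (by simp) _ _))
        ((hf 15 (by simp)).trans (Memory.int_setInt_of_ne _ (by simp) _ _)) hl₂ hb5 hb6 hne
        (Or.inl ⟨?_, ?_, h.extendable.insert_edge hb6 hw' hmax' hsep⟩)
      · simp [hf 5 (by simp), Memory.setInt]
      · simp [hf 6 (by simp), Memory.setInt, hb6]
    · have hsep : ¬ _ := fun h' => (h17.2 h') hy
      have hb19'' : ((entry 19).val (s₂.setInt 5 b 0)).toNat = b := by
        rw [← hb19']; simp [Expr.val, Memory.setInt]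
      rw [hb19', show (Expr.const 0).val s₂ = 0 from rfl, hb19'',
        show (Expr.const 1).val (s₂.setInt 5 b 0) = 1 from rfl]
      refine h.decide_edge b ?_ ?_ ((hl₂.setInt (by simp) _ _).setInt (by simp) _ _) hb5 hb6 ?_
        (Or.inr ⟨?_, ?_, h.extendable.sdiff_of_not hsep⟩)
      · simp [Memory.int_setInt_of_ne, hf 13]
      · simp [Memory.int_setInt_of_ne, hf 15]
      · intro e heb
        have : (e : ℕ) ≠ b := fun h' => heb (Fin.ext h')
        simpa [Memory.setInt, this] using hne e heb
      · simp [Memory.setInt]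
      · simp [Memory.setInt]

theorem ensures_greedy (I : Input Γ) : greedy.Ensures I.sums I.memory fun s =>
    ∃ F : Finset (Fin I.m), I.Outputs s F ∧ I.IsFeasible F ∧
      ∀ F' : Finset (Fin I.m), I.IsFeasible F' → ∑ e ∈ F', I.weight e ≤ ∑ e ∈ F, I.weight e := by
  have hl := I.memory_loaded
  refine Ensures.seq ((ensures_findRoots hl (fun _ => rfl) fun _ => rfl).frame.mono
    fun s₁ ⟨hR, hf₁, hg₁⟩ => ?_)
  simp only [mem_writes_findRoots] at hf₁
  have hl₁ : Loaded I s₁ := hl.of_eq (fun a ha => hf₁ a (by omega))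
    (hg₁ 0 (by simp [findRoots, groupWrites, groupWrites_findComponents, searchMarked]))
    (hg₁ 2 (by simp [findRoots, groupWrites, groupWrites_findComponents, searchMarked]))
  refine Ensures.seq ((ensures_absWeights hl₁).frame.mono fun s₂ ⟨habs, hf₂, hg₂⟩ => ?_)
  simp only [mem_writes_absWeights] at hf₂
  have hl₂ : Loaded I s₂ := hl₁.of_eq (fun a ha => hf₂ a (by omega))
    (hg₂ 0 (by simp [absWeights, groupWrites])) (hg₂ 2 (by simp [absWeights, groupWrites]))
  rw [← hf₂ 15 (by simp)] at hR
  have h5 : ∀ i, s₂.int 5 i = 0 := fun i => by rw [hf₂ 5 (by simp), hf₁ 5 (by simp)]; rfl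
  have h6 : ∀ i, s₂.int 6 i = 0 := fun i => by rw [hf₂ 6 (by simp), hf₁ 6 (by simp)]; rfl
  set R : Fin I.n → Prop := fun v => s₂.int 15 v ≠ 0 with hRdef
  have hstart : GreedyState I R s₂ := by
    refine ⟨hl₂, habs, rfl, fun e => Or.inl (h5 e), fun e => Or.inl (h6 e), ?_⟩
    have hX : {e : Fin I.m | s₂.int 5 e = 1} = ∅ := by ext; simp [h5]
    have hZ : {e : Fin I.m | s₂.int 6 e = 0} = Set.univ := by ext; simp [h6]
    rw [hX, hZ]
    exact (Input.IsRoots.separable I hR).extendable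
  refine Ensures.count hl₂.m
    (fun k s' => GreedyState I R s' ∧ (undecided I s').card ≤ I.m - k) ⟨hstart, ?_⟩ ?_ ?_
  · simpa using Finset.card_le_univ (undecided I s₂)
  · intro k hk s' ⟨hG, hcard⟩ _ _
    have hG' : GreedyState I R (s'.setInt 27 0 k) :=
      ⟨hG.loaded.setInt (by simp) _ _, by simpa [Memory.setInt] using hG.abs,
        by simpa [Memory.setInt] using hG.roots, by simpa [Memory.setInt] using hG.bit_in,
        by simpa [Memory.setInt] using hG.bit_out, by simpa [Memory.setInt] using hG.extendable⟩
    have hcard' : (undecided I (s'.setInt 27 0 k)).card ≤ I.m - k := by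
      simpa [undecided, Memory.setInt] using hcard
    generalize s'.setInt 27 0 k = s₃ at hG' hcard'
    refine Ensures.seq ((ensures_selectEdge hG'.loaded hG'.abs).frame.mono
      fun s₄ ⟨⟨hs0, hs1⟩, hf₄, hg₄⟩ => ?_)
    simp only [mem_writes_selectEdge] at hf₄
    have e5 := hf₄ 5 (by simp)
    have e6 := hf₄ 6 (by simp)
    have hund : undecided I s₄ = undecided I s₃ := by simp only [undecided, e5, e6]
    have hG₄ : GreedyState I R s₄ := by
      refine ⟨hG'.loaded.of_eq (fun a ha => hf₄ a (by omega))
        (hg₄ 0 (by simp [selectEdge, groupWrites])) (hg₄ 2 (by simp [selectEdge, groupWrites])),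
        ?_, ?_, ?_, ?_, ?_⟩
      · rw [hf₄ 13 (by simp)]; exact hG'.abs
      · rw [hf₄ 15 (by simp)]; exact hG'.roots
      · rw [e5]; exact hG'.bit_in
      · rw [e6]; exact hG'.bit_out
      · rw [e5, e6]; exact hG'.extendable
    refine (ensures_decideEdge hG₄ (fun h0 => ?_) fun h1 => ?_).mono fun s₅ ⟨hG₅, hc⟩ => ⟨hG₅, ?_⟩
    · rw [hund]
      exact Finset.filter_eq_empty_iff.2 fun e _ => hs0 h0 e
    · obtain ⟨b, hb1, hb2, hb3, hb4⟩ := hs1 h1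
      rw [hund]
      refine ⟨b, hb1, by simp [undecided, hb2, hb3], fun e he => ?_⟩
      simp only [undecided, Finset.mem_filter, Finset.mem_univ, true_and] at he
      exact hb4 e he.1 he.2
    · rw [hund] at hc
      clear hs0 hs1
      omega
  · rintro s' ⟨hG, hcard⟩
    rw [Nat.sub_self, Nat.le_zero, Finset.card_eq_zero] at hcard
    obtain ⟨F, hXF, hFZ, hF, hopt⟩ := hG.extendable
    have hmem : ∀ e : Fin I.m, e ∈ F ↔ s'.int 5 e = 1 := by
      refine fun e => ⟨fun he => ?_, fun he => hXF he⟩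
      refine (hG.bit_in e).resolve_left fun h0 => ?_
      have : e ∈ undecided I s' := by simpa [undecided, h0] using hFZ he
      simp [hcard] at this
    classical
    have hcoe : ((Finset.univ.filter (· ∈ F) : Finset (Fin I.m)) : Set (Fin I.m)) = F := by
      ext; simp
    refine ⟨Finset.univ.filter (· ∈ F), fun e => ?_, ?_, fun F' hF' => ?_⟩
    · rw [Memory.int_setInt_of_ne _ (by simp)]
      simp only [Finset.mem_filter, Finset.mem_univ, true_and, hmem]
      split_ifs with he
      · exact he
      · exact (hG.bit_in e).resolve_right he
    · rw [I.isFeasible_iff hR, hcoe]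
      exact hF
    · have := hopt _ ((I.isFeasible_iff hR F').1 hF')
      have hw : ∀ A : Finset (Fin I.m),
          totalWeight I.weight (A : Set (Fin I.m)) = ∑ e ∈ A, I.weight e := by
        intro A
        exact Finset.sum_congr (by ext; simp) fun _ _ => rfl
      rwa [← hw, ← hw, hcoe]

theorem natSize_le_self (n : ℕ) : n.size ≤ n := Nat.size_le.2 n.lt_two_pow_self

theorem Input.memory_int_zero_le (T : GroupCosts Γ) (j : ℕ) :
    I.memory.int 0 j ≤ I.length T := by
  have hn := I.n_le_length T
  have hm := I.m_le_length T
  simp only [Input.memory, toArray]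
  split_ifs with h
  · interval_cases j <;> simp <;> omega
  · omega

theorem Input.memory_small (T : GroupCosts Γ) : I.memory.Small (I.length T + 1) := by
  have hn := I.n_le_length T
  have hm := I.m_le_length T
  have hn' := natSize_le_self I.n
  have hm' := natSize_le_self I.m
  intro a i
  have hzero : intLength 0 ≤ I.length T + 1 := by simp [intLength]
  match a with
  | 0 =>
    simp only [Input.memory, toArray]
    split_ifs with h
    · interval_cases i <;> simp [intLength] <;> omega
    · exact hzero
  | 1 | 2 | 3 | 4 =>
    simp only [Input.memory, toArray]
    split_ifs with h
    · have := I.edge_length_le T ⟨i, h⟩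
      simp only [intLength, Int.natAbs_natCast]
      omega
    · exact hzero
  | _ + 5 => exact hzero

end Correctness

end GammaGraphic

end

theorem theorem2 :
    ∃ P : GammaGraphic.Prog, ∀ q : Polynomial ℕ, ∃ p : Polynomial ℕ,
      ∀ (Γ : Type*) [AddCommGroup Γ] (T : GammaGraphic.GroupCosts Γ) (I : GammaGraphic.Input Γ),
        I.OpsBoundedBy T (q.eval (I.length T)) →
        ∃ (s : GammaGraphic.Memory Γ) (t : ℕ) (F : Finset (Fin I.m)),
          GammaGraphic.Exec T P I.memory s t ∧
          t ≤ p.eval (I.length T) ∧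
          I.Outputs s F ∧
          I.IsFeasible F ∧
          ∀ F' : Finset (Fin I.m), I.IsFeasible F' →
            ∑ e ∈ F', I.weight e ≤ ∑ e ∈ F, I.weight e := by
  refine ⟨GammaGraphic.greedy.compile, fun q =>
    ⟨GammaGraphic.greedy.time q (Polynomial.X + 1), fun Γ _ T I hops => ?_⟩⟩
  obtain ⟨hsafe, F, hout, hF, hopt⟩ := GammaGraphic.ensures_greedy I
  obtain ⟨-, t, ht, hexec⟩ := GammaGraphic.Cmd.exec_compile (T := T) (K := I.sums)
    (N := I.length T) (b := q) (fun g ⟨A, hA⟩ h ⟨B, hB⟩ => hA ▸ hB ▸ hops.1 A B)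
    (fun g ⟨A, hA⟩ => hA ▸ hops.2 A) GammaGraphic.greedy GammaGraphic.greedy_wellFormed
    GammaGraphic.zero_notMem_writes_greedy (Polynomial.X + 1) I.memory
    (I.memory_int_zero_le T) (by simpa using I.memory_small T) hsafe
  exact ⟨_, t, F, hexec, ht, hout, hF, hopt⟩
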